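/- **Setting.** Let $R_f,R_\delta$ be correlation functions on $[0,1]^p$ (symmetric, positive semidefinite, equal to $1$ on the diagonal, measurable in each argument), $\mu_f\in\mathbb R$, $\sigma_f^2,\sigma_\delta^2,\sigma_\epsilon^2\ge 0$, and $c\in\mathbb R$. The computer output $f\sim \mathrm{GP}(\mu_f,\sigma_f^2R_f)$ and the discrepancy $\delta\sim\mathrm{GP}(0,\sigma_\delta^2R_\delta)$ are independent, and $\xi=f+\delta$. A physical run at $x$ has latent response $y'=\xi(x)+\epsilon$, where the errors $\epsilon\sim N(0,\sigma_\epsilon^2)$ are i.i.d. and independent of $(f,\delta)$; a latent response is right-censored at $c$. There are $n-m$ computer runs with outputs $\boldsymbol f=(f(x_i))_{i\le n-m}$ (no noise, no censoring) and $m=n_o+n_c$ physical runs with data $\mathcal Y_m=\{\boldsymbol y_o,\ \boldsymbol y_c'\ge\boldsymbol c\}$: $n_o$ responses are observed exactly and $n_c$ are known to be at least $c$. Runs are listed in the order computer, observed, censored, and are followed by a potential physical run at $x_{n+1}\in[0,1]^p$ with latent response $Y_{n+1}'$ and observation $Y_{n+1}=Y_{n+1}'\mathbf 1\{Y'_{n+1}<c\}+c\,\mathbf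 1\{Y_{n+1}'\ge c\}$. For $k\in\{n,n+1\}$ let $$\boldsymbol\Gamma_k=\sigma_f^2[R_f(x_i,x_j)]_{i,j\le k}+\mathrm{diag}\big(\boldsymbol 0_{n-m},\ \sigma_\delta^2[R_\delta(x_i,x_j)]_{n-m<i,j\le k}+\sigma_\epsilon^2 \boldsymbol I\big),$$ $$\boldsymbol\gamma_{k,\rm new}=\sigma_f^2[R_f(x_i,x_{\rm new})]_{i\le k}+\sigma_\delta^2\big[\boldsymbol 0_{n-m},\ (R_\delta(x_i,x_{\rm new}))_{n-m<i\le k}\big],$$ and suppose that $\boldsymbol\Gamma_{n+1}$ is invertible. **Claim.** The conditional laws of $(\xi(x_{\rm new}),\boldsymbol y_c',Y_{n+1}')$ (for every $x_{\rm new}\in[0,1]^p$) and of $(\boldsymbol y_c',Y_{n+1}')$ given $(\boldsymbol f,\boldsymbol y_o)$ have unique versions that are weakly continuous in the value of $(\boldsymbol f,\boldsymbol y_o)$. With conditioning understood in this sense, for all values of the data $(\boldsymbol f,\boldsymbol y_o)$ the two integrands below are integrable and $$\mathrm{ICMSE}(x_{n+1})=\int_{[0,1]^p}\mathbb E_{Y_{n+1}\mid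 \boldsymbol f,\mathcal Y_m}\big[\mathrm{Var}(\xi(x_{\rm new})\mid \boldsymbol f,\mathcal Y_m,Y_{n+1})\big]\,dx_{\rm new} =\int_{[0,1]^p}\sigma^2_{\rm new}-\boldsymbol\gamma_{n+1,\rm new}^T\boldsymbol\Gamma_{n+1}^{-1}\boldsymbol H_c(x_{n+1})\boldsymbol\Gamma_{n+1}^{-1}\boldsymbol\gamma_{n+1,\rm new}\,dx_{\rm new}.$$ Here, for every $x_{\rm new}$, $$\sigma^2_{\rm new}=\mathrm{Var}[\xi(x_{\rm new})\mid \boldsymbol f,\mathcal Y_m]=\sigma_f^2+\sigma_\delta^2-\boldsymbol\gamma_{n,\rm new}^T\big(\boldsymbol\Gamma_n^{-1}-\boldsymbol\Gamma_n^{-1}\boldsymbol\Sigma\boldsymbol\Gamma_n^{-1}\big)\boldsymbol\gamma_{n,\rm new},\qquad \boldsymbol\Sigma=\mathrm{diag}\big(\boldsymbol 0_{n-n_c},\mathrm{Var}[\boldsymbol y_c'\mid \boldsymbol f,\mathcal Y_m]\big),$$ and $$\boldsymbol H_c(x_{n+1})=(1-\lambda)(\boldsymbol\Sigma_1-\hat{\boldsymbol\Sigma})+\lambda(1-\lambda)\,\mathrm{diag}\big(\boldsymbol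 0_{n-n_c},\boldsymbol d\boldsymbol d^T\big),$$ where * $\lambda=\mathbb P(\boldsymbol y_c'\ge\boldsymbol c,\,Y_{n+1}'\ge c\mid \boldsymbol f,\boldsymbol y_o)\,/\,\mathbb P(\boldsymbol y_c'\ge\boldsymbol c\mid \boldsymbol f,\boldsymbol y_o)$, * $\boldsymbol\Sigma_1=\mathrm{diag}\big(\boldsymbol 0_{n-n_c},\mathrm{Var}[(\boldsymbol y_c',Y_{n+1}')\mid \boldsymbol f,\mathcal Y_m,Y_{n+1}'<c]\big)$, * $\hat{\boldsymbol\Sigma}=\mathrm{diag}\big(\boldsymbol 0_{n-n_c},\ \mathbb E_{Y'_{n+1}\mid \boldsymbol f,\mathcal Y_m,Y_{n+1}'<c}[\mathrm{Var}(\boldsymbol y_c'\mid \boldsymbol f,\mathcal Y_m,Y_{n+1}')],\ 0\big)$, * $\boldsymbol d=\mathbb E[(\boldsymbol y_c',Y_{n+1}')\mid \boldsymbol f,\mathcal Y_m,Y_{n+1}'\ge c]-\mathbb E[(\boldsymbol y_c',Y_{n+1}')\mid \boldsymbol f,\mathcal Y_m,Y_{n+1}'<c]$. -/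

import Mathlib

open MeasureTheory ProbabilityTheory
open scoped NNReal ENNReal Matrix

namespace BiFidelity

/-- The input space `[0,1]^p`. -/
abbrev Input (p : ℕ) : Type := Fin p → unitInterval

/-- A correlation function: symmetric, positive semidefinite, equal to one on the diagonal. -/
structure IsCorrelation {X : Type*} (R : X → X → ℝ) : Prop where
  diag : ∀ x, R x x = 1
  symm : ∀ x y, R x y = R y x
  posSemidef : ∀ (s : Finset X) (w : X → ℝ), 0 ≤ ∑ x ∈ s, ∑ y ∈ s, w x * w y * R x y

/-- The process `Z` is `GP(m, v R)`: Gaussian, with constant mean `m` and covariance function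
`v R`. -/
structure IsGP {Ω X : Type*} [MeasurableSpace Ω] (Z : X → Ω → ℝ) (m : ℝ) (v : ℝ≥0)
    (R : X → X → ℝ) (P : Measure Ω) : Prop where
  gaussian : IsGaussianProcess Z P
  mean : ∀ x, ∫ ω, Z x ω ∂P = m
  cov : ∀ x y, cov[Z x, Z y; P] = (v : ℝ) * R x y

/-- Model parameters and design: `nf` computer runs, `no` physical runs whose response is observed,
`nc` physical runs whose response is right-censored, and the censoring limit. -/
structure Experiment (p nf no nc : ℕ) where
  /-- mean of the computer output -/
  meanF : ℝ
  /-- prior variance of the computer output -/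
  varF : ℝ≥0
  /-- prior variance of the discrepancy -/
  varD : ℝ≥0
  /-- variance of the physical measurement noise -/
  varE : ℝ≥0
  /-- correlation function of the computer output -/
  corrF : Input p → Input p → ℝ
  /-- correlation function of the discrepancy -/
  corrD : Input p → Input p → ℝ
  /-- inputs of the computer runs -/
  xF : Fin nf → Input p
  /-- inputs of the uncensored physical runs -/
  xO : Fin no → Input p
  /-- inputs of the censored physical runs -/
  xC : Fin nc → Input p
  /-- right-censoring limit -/
  limit : ℝ

/-- Labels of the physical responses that are not observed exactly: the `nc` censored ones and the
potential next one, `Sum.inr ()`. -/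
abbrev Latent (nc : ℕ) : Type := Fin nc ⊕ Unit

/-- Labels of all physical responses, in the order: observed, censored, potential next one. -/
abbrev Phys (no nc : ℕ) : Type := Fin no ⊕ Latent nc

/-- Values of the exactly observed data: computer outputs and uncensored responses. -/
abbrev Data (nf no : ℕ) : Type := (Fin nf → ℝ) × (Fin no → ℝ)

section Conditioning

variable {Ω α β : Type*} [MeasurableSpace Ω]
  [TopologicalSpace α] [MeasurableSpace α]
  [TopologicalSpace β] [MeasurableSpace β] [OpensMeasurableSpace β] [StandardBorelSpace β]
  [Nonempty β]

/-- `κ` is a version of the conditional distribution of `W` given `A` which depends weakly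
continuously on the value of `A`. -/
structure IsContCondLaw (W : Ω → β) (A : Ω → α) (P : Measure Ω) [IsFiniteMeasure P]
    (κ : α → ProbabilityMeasure β) : Prop where
  continuous : Continuous κ
  version : ∀ᵐ a ∂(P.map A), condDistrib W A P a = (κ a : Measure β)

open Classical in
/-- The conditional law of `W` given `A = a`, in its continuous version (and `0` if there is no
such version). -/
noncomputable def condLaw (W : Ω → β) (A : Ω → α) (P : Measure Ω) [IsFiniteMeasure P] (a : α) :
    Measure β :=
  if h : ∃ κ : α → ProbabilityMeasure β, IsContCondLaw W A P κ then (h.choose a : Measure β) else 0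

end Conditioning

/-- The observation after right-censoring of the latent response `y` at `c`. -/
noncomputable def censor (c y : ℝ) : ℝ := if c ≤ y then c else y

namespace Experiment

variable {p nf no nc : ℕ} (S : Experiment p nf no nc)

/-- Inputs of all physical runs, the last one being the potential next run at `xnext`. -/
def xPhys (xnext : Input p) : Phys no nc → Input p := Sum.elim S.xO (Sum.elim S.xC fun _ => xnext)

/-- Inputs of the physical runs in the training data. -/
def xTrain : Fin no ⊕ Fin nc → Input p := Sum.elim S.xO S.xC

/-- Covariance matrix of the responses at the computer inputs and at physical inputs `z`:
`Γ = σ_f² [R_f] + diag(0, σ_δ² [R_δ] + σ_ε² I)`. -/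
noncomputable def gram {Q : Type*} [DecidableEq Q] (z : Q → Input p) :
    Matrix (Fin nf ⊕ Q) (Fin nf ⊕ Q) ℝ :=
  (S.varF : ℝ) • Matrix.of (fun i j => S.corrF (Sum.elim S.xF z i) (Sum.elim S.xF z j)) +
    Matrix.fromBlocks 0 0 0
      ((S.varD : ℝ) • Matrix.of (fun i j => S.corrD (z i) (z j)) +
        (S.varE : ℝ) • (1 : Matrix Q Q ℝ))

/-- Covariance vector between these responses and `ξ(x)`:
`γ = σ_f² [R_f(x_i, x)] + σ_δ² [0, R_δ(x_i, x)]`. -/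
noncomputable def crossCov {Q : Type*} (z : Q → Input p) (x : Input p) : Fin nf ⊕ Q → ℝ :=
  (S.varF : ℝ) • (fun i => S.corrF (Sum.elim S.xF z i) x) +
    (S.varD : ℝ) • Sum.elim (fun _ => 0) (fun i => S.corrD (z i) x)

section Criterion

variable {Ω : Type*} [MeasurableSpace Ω]
  (f δ : Input p → Ω → ℝ) (ε : Phys no nc → Ω → ℝ) (P : Measure Ω) (xnext : Input p)

/-- The bi-fidelity model: `f ~ GP(μ_f, σ_f² R_f)` and `δ ~ GP(0, σ_δ² R_δ)` are independent, and
the noise variables are i.i.d. `N(0, σ_ε²)` and independent of `(f, δ)`. -/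
structure IsModel : Prop where
  corrF : IsCorrelation S.corrF
  corrD : IsCorrelation S.corrD
  gpF : IsGP f S.meanF S.varF S.corrF P
  gpD : IsGP δ 0 S.varD S.corrD P
  noise_law : ∀ q, P.map (ε q) = gaussianReal 0 S.varE
  noise_indep : iIndepFun ε P
  indep_f_delta : IndepFun (fun ω x => f x ω) (fun ω x => δ x ω) P
  indep_noise : IndepFun (fun ω => ((fun x => f x ω), (fun x => δ x ω))) (fun ω q => ε q ω) P

/-- The mean physical response `ξ = f + δ`. -/
def xi (x : Input p) (ω : Ω) : ℝ := f x ω + δ x ω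

/-- The physical responses before censoring, `y' = ξ(x) + ε`. -/
def response (q : Phys no nc) (ω : Ω) : ℝ := xi f δ (S.xPhys xnext q) ω + ε q ω

/-- The exactly observed random quantities: the computer outputs and the uncensored responses. -/
def exactData (ω : Ω) : Data nf no :=
  (fun i => f (S.xF i) ω, fun i => S.response f δ ε xnext (Sum.inl i) ω)

/-- The latent vector `(y_c', Y'_{n+1})`. -/
def latent (ω : Ω) : Latent nc → ℝ := fun l => S.response f δ ε xnext (Sum.inr l) ω

variable [IsFiniteMeasure P] (a : Data nf no)

/-- Law of `(ξ(x), (y_c', Y'_{n+1}))` given all the training data, that is, given the exactly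
observed values `a` and the event `y_c' ≥ c`. -/
noncomputable def posterior (x : Input p) : Measure (ℝ × (Latent nc → ℝ)) :=
  (condLaw (fun ω => (xi f δ x ω, S.latent f δ ε xnext ω)) (S.exactData f δ ε xnext) P a)[|
    {w | ∀ j : Fin nc, S.limit ≤ w.2 (Sum.inl j)}]

/-- Predictive variance `σ²_new` of `ξ(x)` given the training data. -/
noncomputable def predVar (x : Input p) : ℝ :=
  Var[fun w => w.1; S.posterior f δ ε P xnext a x]

/-- Expected conditional variance of `ξ(x)` given the training data and the (possibly censored)
next observation `Y_{n+1}`, the expectation being over `Y_{n+1}` given the training data. -/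
noncomputable def cmse (x : Input p) : ℝ :=
  ∫ w, (Var[fun w => w.1; S.posterior f δ ε P xnext a x |
    MeasurableSpace.comap
      (fun w : ℝ × (Latent nc → ℝ) => censor S.limit (w.2 (Sum.inr ()))) inferInstance]) w
    ∂(S.posterior f δ ε P xnext a x)

/-- The design criterion: the average of `cmse` over the input space. -/
noncomputable def icmse : ℝ := ∫ x : Input p, S.cmse f δ ε P xnext a x

/-- Law of the latent vector `(y_c', Y'_{n+1})` given the exactly observed values. -/
noncomputable def latentLaw : Measure (Latent nc → ℝ) :=
  condLaw (S.latent f δ ε xnext) (S.exactData f δ ε xnext) P a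

/-- The event `y_c' ≥ c`. -/
def trainCensored : Set (Latent nc → ℝ) := {w | ∀ j : Fin nc, S.limit ≤ w (Sum.inl j)}

/-- The event `Y'_{n+1} ≥ c`. -/
def nextCensored : Set (Latent nc → ℝ) := {w | S.limit ≤ w (Sum.inr ())}

/-- The event `Y'_{n+1} < c`. -/
def nextUncensored : Set (Latent nc → ℝ) := {w | w (Sum.inr ()) < S.limit}

/-- Law of the latent vector given all the training data. -/
noncomputable def latentPost : Measure (Latent nc → ℝ) :=
  (S.latentLaw f δ ε P xnext a)[|S.trainCensored]

/-- The same, given also that the next observation is censored. -/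
noncomputable def postCensored : Measure (Latent nc → ℝ) :=
  (S.latentPost f δ ε P xnext a)[|S.nextCensored]

/-- The same, given instead that the next observation is not censored. -/
noncomputable def postUncensored : Measure (Latent nc → ℝ) :=
  (S.latentPost f δ ε P xnext a)[|S.nextUncensored]

/-- Posterior probability of censoring,
`λ = P(y_c' ≥ c, Y'_{n+1} ≥ c | f, y_o) / P(y_c' ≥ c | f, y_o)`. -/
noncomputable def censorProb : ℝ :=
  (S.latentLaw f δ ε P xnext a).real (S.trainCensored ∩ S.nextCensored) /
    (S.latentLaw f δ ε P xnext a).real S.trainCensored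

/-- Block-diagonal extension `diag(0, M)` by zero to all `n + 1` runs (or to the `n` training
runs), `M` being indexed by the last physical runs. -/
def pad {L : Type*} (M : Matrix L L ℝ) :
    Matrix (Fin nf ⊕ (Fin no ⊕ L)) (Fin nf ⊕ (Fin no ⊕ L)) ℝ :=
  Matrix.fromBlocks 0 0 0 (Matrix.fromBlocks 0 0 0 M)

/-- `Var[y_c' | f, y_o, y_c' ≥ c]`. -/
noncomputable def censoredCov : Matrix (Fin nc) (Fin nc) ℝ :=
  Matrix.of fun i j =>
    cov[fun w => w (Sum.inl i), fun w => w (Sum.inl j); S.latentPost f δ ε P xnext a]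

/-- `Var[(y_c', Y'_{n+1}) | f, y_o, y_c' ≥ c, Y'_{n+1} < c]`. -/
noncomputable def latentCov : Matrix (Latent nc) (Latent nc) ℝ :=
  Matrix.of fun k l => cov[fun w => w k, fun w => w l; S.postUncensored f δ ε P xnext a]

/-- Conditional mean, under `ν`, of coordinate `l` of the latent vector given `Y'_{n+1}`. -/
noncomputable def condMeanNext (ν : Measure (Latent nc → ℝ)) (l : Latent nc) :
    (Latent nc → ℝ) → ℝ :=
  ν[fun v => v l |
    MeasurableSpace.comap (fun w : Latent nc → ℝ => w (Sum.inr ())) inferInstance]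

/-- `E[Var(y_c' | f, y_o, y_c' ≥ c, Y'_{n+1})]`, the expectation being over `Y'_{n+1}` given the
training data and `Y'_{n+1} < c`. -/
noncomputable def meanCondCov : Matrix (Fin nc) (Fin nc) ℝ :=
  Matrix.of fun i j =>
    ∫ w, (w (Sum.inl i) - condMeanNext (S.postUncensored f δ ε P xnext a) (Sum.inl i) w) *
      (w (Sum.inl j) - condMeanNext (S.postUncensored f δ ε P xnext a) (Sum.inl j) w)
      ∂(S.postUncensored f δ ε P xnext a)

/-- Difference of the means of `(y_c', Y'_{n+1})` given the training data together with
`Y'_{n+1} ≥ c`, respectively `Y'_{n+1} < c`. -/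
noncomputable def meanShift : Latent nc → ℝ := fun l =>
  (∫ w, w l ∂(S.postCensored f δ ε P xnext a)) - ∫ w, w l ∂(S.postUncensored f δ ε P xnext a)

/-- The matrix `H_c(xnext) = (1 - λ) (Σ₁ - Σ̂) + λ (1 - λ) diag(0, d dᵀ)`. -/
noncomputable def hMatrix :
    Matrix (Fin nf ⊕ Phys no nc) (Fin nf ⊕ Phys no nc) ℝ :=
  let lam := S.censorProb f δ ε P xnext a
  let d := S.meanShift f δ ε P xnext a
  (1 - lam) • (pad (S.latentCov f δ ε P xnext a) -
      pad (Matrix.fromBlocks (S.meanCondCov f δ ε P xnext a) 0 0 0)) +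
    (lam * (1 - lam)) • pad (Matrix.vecMulVec d d)

/-- The explicit integrand `σ²_new - γᵀ Γ⁻¹ H_c Γ⁻¹ γ`. -/
noncomputable def explicitIntegrand (x : Input p) : ℝ :=
  let Γ := S.gram (S.xPhys xnext)
  let γ := S.crossCov (S.xPhys xnext) x
  S.predVar f δ ε P xnext a x - γ ⬝ᵥ ((Γ⁻¹ * S.hMatrix f δ ε P xnext a * Γ⁻¹) *ᵥ γ)

end Criterion

end Experiment

end BiFidelity

/-! The proof is Gaussian regression followed by the law of total variance. The runs and `ξ(x)` are
jointly Gaussian, so with `β = Γ⁻¹γ` the residual `R = ξ(x) - ∑ βᵢ Tᵢ` is uncorrelated with every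
run `Tᵢ`, hence independent of all of them. Likewise each latent response is a linear function of
the exact data plus an innovation, and `R` and the innovations are jointly independent of the data.

Freezing the data at `a` in these formulas gives an explicit version of the conditional law
(`isContCondLaw_of_indepFun`), weakly continuous in `a` by dominated convergence. It is the only
continuous one because `Γ` is positive definite, so the data have full support. Full support of the
latent vector given `a` also keeps the censoring probability `λ` strictly between 0 and 1.

Under the posterior, `ξ(x) = k + ∑ b_l w_l + residual`, where `b` is the latent part of `β` and the
residual is independent of the latent vector `w`. Hence the expected conditional variance is `Var
ξ(x)` minus the variance of `E[∑ b_l w_l | Y_{n+1}]`. The latter is a constant where the observation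
is censored and the conditional mean given `Y'_{n+1}` elsewhere (`condExp_comap_censor`). The
variance of this two-component mixture is `(1-λ)` times an uncensored term plus `λ(1-λ)(b·d)²`.
Total variance under the uncensored law turns the first term into `Σ₁ - Σ̂`, so the sum is the
quadratic form `βᵀ H_c β` (`integral_condVar_comap_censor`, `dotProduct_hMatrix_mulVec`).

For `σ²_new` the regression uses the training runs only. The residual keeps its prior variance, and
the censored responses add the variance of their linear combination (`predVar_eq`). Integrability
holds because everything is a quadratic form in bounded measurable covariances. -/

namespace BiFidelity

/-! ### Conditioning a measure on an event. -/

section Conditional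

lemma cond_map {α β : Type*} [MeasurableSpace α] [MeasurableSpace β] {μ : Measure α} {f : α → β}
    (hf : AEMeasurable f μ) {s : Set β} (hs : MeasurableSet s) :
    (μ.map f)[|s] = (μ[|f ⁻¹' s]).map f := by
  rw [ProbabilityTheory.cond, ProbabilityTheory.cond, Measure.map_smul,
    Measure.map_apply_of_aemeasurable hf hs, Measure.restrict_map_of_aemeasurable hf hs]

lemma memLp_cond {α : Type*} [MeasurableSpace α] {μ : Measure α} {X : α → ℝ} {p : ℝ≥0∞}
    (hX : MemLp X p μ) {s : Set α} (hs : μ s ≠ 0) : MemLp X p μ[|s] := by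
  rw [ProbabilityTheory.cond]
  exact hX.restrict s |>.smul_measure (ENNReal.inv_ne_top.2 hs)

variable {Ω β γ : Type*} [MeasurableSpace Ω] [MeasurableSpace β] [MeasurableSpace γ]
  {μ : Measure Ω} {R : Ω → β} {V : Ω → γ} {B : Set γ}

lemma map_cond_of_indepFun [IsProbabilityMeasure μ] (h : IndepFun R V μ) (hR : Measurable R)
    (hV : Measurable V)
    (hB : MeasurableSet B) (hne : μ (V ⁻¹' B) ≠ 0) :
    (μ[|V ⁻¹' B]).map R = μ.map R := by
  ext s hs
  rw [Measure.map_apply hR hs, Measure.map_apply hR hs, cond_apply (hV hB), Set.inter_comm,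
    h.measure_inter_preimage_eq_mul _ _ hs hB, mul_comm, mul_assoc,
    ENNReal.mul_inv_cancel hne (measure_ne_top _ _), mul_one]

/-- Conditioning on `V ∈ B` only replaces a test set `t` for `V` by `B ∩ t`, so the product formula
survives the normalisation. -/
lemma indepFun_cond_of_indepFun [IsProbabilityMeasure μ] (h : IndepFun R V μ) (hR : Measurable R)
    (hV : Measurable V) (hB : MeasurableSet B) (hne : μ (V ⁻¹' B) ≠ 0) :
    IndepFun R V μ[|V ⁻¹' B] := by
  rw [indepFun_iff_measure_inter_preimage_eq_mul]
  intro s t hs ht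
  have h1 := congrArg (fun ν => ν s) (map_cond_of_indepFun h hR hV hB hne)
  simp only [Measure.map_apply hR hs] at h1
  rw [h1, cond_apply (hV hB), cond_apply (hV hB),
    show V ⁻¹' B ∩ (R ⁻¹' s ∩ V ⁻¹' t) = R ⁻¹' s ∩ V ⁻¹' (B ∩ t) by ext; simp; tauto,
    h.measure_inter_preimage_eq_mul _ _ hs (hB.inter ht), Set.preimage_inter]
  ring

end Conditional

/-! ### Existence and uniqueness of weakly continuous conditional laws. -/

section ContinuousVersion

set_option linter.unusedSectionVars false

variable {Ω α β γ : Type*} [MeasurableSpace Ω]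
  [TopologicalSpace α] [FirstCountableTopology α] [MeasurableSpace α] [BorelSpace α]
  [TopologicalSpace β] [MeasurableSpace β] [BorelSpace β] [StandardBorelSpace β] [Nonempty β]
  [MeasurableSpace γ]
  {P : Measure Ω} [IsProbabilityMeasure P]
  {W : Ω → β} {A : Ω → α} {V : Ω → γ} {g : γ → α → β}

/-- By independence `(A, V)` has a product law. Integrating over `V` with `A = a` frozen exhibits
the law of `g V a` as the disintegration kernel of `(A, W)`. -/
lemma measure_map_prodMk_eq_compProd
    (hA : AEMeasurable A P) (hV : AEMeasurable V P) (hind : IndepFun A V P)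
    (hg : Measurable (Function.uncurry g)) (hW : W = fun ω => g (V ω) (A ω)) :
    P.map (fun ω => (A ω, W ω)) = P.map A ⊗ₘ
      ((Kernel.id : Kernel α α) ×ₖ Kernel.const α (P.map V)).map (fun q => g q.2 q.1) := by
  have : IsProbabilityMeasure (P.map V) := Measure.isProbabilityMeasure_map hV
  have hg' : Measurable fun q : α × γ => g q.2 q.1 := hg.comp measurable_swap
  have hG : Measurable fun q : α × γ => (q.1, g q.2 q.1) := measurable_fst.prodMk hg'
  ext s hs
  have h1 : P.map (fun ω => (A ω, W ω)) =
      ((P.map A).prod (P.map V)).map fun q : α × γ => (q.1, g q.2 q.1) := by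
    rw [← (indepFun_iff_map_prod_eq_prod_map_map hA hV).1 hind,
      AEMeasurable.map_map_of_aemeasurable hG.aemeasurable (hA.prodMk hV), hW]
    rfl
  rw [h1, Measure.map_apply hG hs, Measure.prod_apply (hG hs), Measure.compProd_apply hs]
  refine lintegral_congr fun a => ?_
  rw [Kernel.map_apply _ hg', Kernel.prod_apply, Kernel.id_apply, Kernel.const_apply,
    Measure.map_apply hg' (measurable_prodMk_left hs), Measure.dirac_prod,
    Measure.map_apply measurable_prodMk_left (hg' (measurable_prodMk_left hs))]
  rfl

/-- For a bounded continuous `φ`, the integral of `φ (g V a)` is continuous in `a` by dominated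
convergence with the constant bound `‖φ‖`. That this is a version is almost sure uniqueness of
disintegrations. -/
lemma isContCondLaw_of_indepFun
    (hA : AEMeasurable A P) (hV : AEMeasurable V P) (hind : IndepFun A V P)
    (hg : Measurable (Function.uncurry g)) (hc : ∀ v, Continuous (g v))
    (hW : W = fun ω => g (V ω) (A ω)) {κ : α → ProbabilityMeasure β}
    (hκ : ∀ a, (κ a : Measure β) = P.map fun ω => g (V ω) a) :
    IsContCondLaw W A P κ := by
  have hga (a : α) : Measurable fun v => g v a := hg.comp measurable_prodMk_right
  have hgV (a : α) : AEMeasurable (fun ω => g (V ω) a) P := (hga a).comp_aemeasurable hV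
  have hg' : Measurable fun q : α × γ => g q.2 q.1 := hg.comp measurable_swap
  constructor
  · rw [ProbabilityMeasure.continuous_iff_forall_continuous_integral]
    intro φ
    have (a : α) : ∫ y, φ y ∂(κ a : Measure β) = ∫ ω, φ (g (V ω) a) ∂P := by
      rw [hκ]
      exact integral_map (hgV a) φ.continuous.measurable.aestronglyMeasurable
    simp_rw [this]
    refine continuous_of_dominated (bound := fun _ => ‖φ‖) (fun a => ?_) (fun a => ?_)
      (integrable_const _) ?_
    · exact (φ.continuous.measurable.comp_aemeasurable (hgV a)).aestronglyMeasurable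
    · exact .of_forall fun ω => φ.norm_coe_le_norm _
    · exact .of_forall fun ω => φ.continuous.comp (hc _)
  · have hWm : AEMeasurable W P := by rw [hW]; exact hg.comp_aemeasurable (hV.prodMk hA)
    have : IsProbabilityMeasure (P.map V) := Measure.isProbabilityMeasure_map hV
    filter_upwards [condDistrib_ae_eq_of_measure_eq_compProd A hWm
      (measure_map_prodMk_eq_compProd hA hV hind hg hW)] with a ha
    rw [ha, hκ, Kernel.map_apply _ hg', Kernel.prod_apply, Kernel.id_apply, Kernel.const_apply,
      Measure.dirac_prod, Measure.map_map hg' measurable_prodMk_left,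
      AEMeasurable.map_map_of_aemeasurable (hg'.comp measurable_prodMk_left).aemeasurable hV]
    rfl

lemma exists_isContCondLaw_of_indepFun
    (hA : AEMeasurable A P) (hV : AEMeasurable V P) (hind : IndepFun A V P)
    (hg : Measurable (Function.uncurry g)) (hc : ∀ v, Continuous (g v))
    (hW : W = fun ω => g (V ω) (A ω)) :
    ∃ κ : α → ProbabilityMeasure β, IsContCondLaw W A P κ ∧
      ∀ a, (κ a : Measure β) = P.map fun ω => g (V ω) a := by
  have hgV (a : α) : AEMeasurable (fun ω => g (V ω) a) P :=
    (hg.comp measurable_prodMk_right).comp_aemeasurable hV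
  let κ (a : α) : ProbabilityMeasure β :=
    ⟨P.map fun ω => g (V ω) a, Measure.isProbabilityMeasure_map (hgV a)⟩
  exact ⟨κ, isContCondLaw_of_indepFun hA hV hind hg hc hW fun _ => rfl, fun _ => rfl⟩

/-- Two versions agree almost everywhere, and continuous maps that agree almost everywhere for a
measure of full support are equal. -/
lemma IsContCondLaw.eq [HasOuterApproxClosed β] [(P.map A).IsOpenPosMeasure]
    {κ κ' : α → ProbabilityMeasure β}
    (h : IsContCondLaw W A P κ) (h' : IsContCondLaw W A P κ') : κ = κ' := by
  refine Measure.eq_of_ae_eq (μ := P.map A) ?_ h.continuous h'.continuous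
  filter_upwards [h.version, h'.version] with a ha ha'
  exact Subtype.ext (ha.symm.trans ha')

lemma IsContCondLaw.existsUnique [HasOuterApproxClosed β] [(P.map A).IsOpenPosMeasure]
    {κ : α → ProbabilityMeasure β} (h : IsContCondLaw W A P κ) :
    ∃! κ, IsContCondLaw W A P κ :=
  ⟨κ, h, fun _ h' => h'.eq h⟩

/-- By uniqueness, the version picked by choice in `condLaw` can be replaced by any explicit
continuous one. -/
lemma IsContCondLaw.condLaw_eq [HasOuterApproxClosed β] [(P.map A).IsOpenPosMeasure]
    {κ : α → ProbabilityMeasure β} (h : IsContCondLaw W A P κ) (a : α) :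
    condLaw W A P a = κ a := by
  have hex : ∃ κ, IsContCondLaw W A P κ := ⟨κ, h⟩
  rw [condLaw, dif_pos hex, hex.choose_spec.eq h]

end ContinuousVersion

/-! ### Full support of nondegenerate Gaussian vectors. -/

section Gaussian

set_option linter.unusedSectionVars false

variable {Ω ι : Type*} [MeasurableSpace Ω] [Fintype ι] [DecidableEq ι] {P : Measure Ω}

lemma isOpenPosMeasure_gaussianReal (m : ℝ) {v : ℝ≥0} (hv : v ≠ 0) :
    (gaussianReal m v).IsOpenPosMeasure :=
  (gaussianReal_absolutelyContinuous' m hv).isOpenPosMeasure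

lemma isOpenPosMeasure_map {X Y : Type*} [TopologicalSpace X] [MeasurableSpace X]
    [OpensMeasurableSpace X] [TopologicalSpace Y] [MeasurableSpace Y] [BorelSpace Y]
    {μ : Measure X} [μ.IsOpenPosMeasure] {φ : X → Y} (hφ : Continuous φ)
    (hs : Function.Surjective φ) : (μ.map φ).IsOpenPosMeasure :=
  hφ.isOpenPosMeasure_map hs

lemma isOpenPosMeasure_stdGaussian :
    (stdGaussian (EuclideanSpace ℝ ι)).IsOpenPosMeasure := by
  rw [← map_pi_eq_stdGaussian]
  have (_ : ι) := isOpenPosMeasure_gaussianReal 0 one_ne_zero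
  exact isOpenPosMeasure_map (PiLp.continuous_toLp 2 _) (WithLp.toLp_surjective 2)

-- This law is the image of the standard Gaussian under `x ↦ m + √S x`, which is onto because `√S`
-- is invertible.
open scoped MatrixOrder Matrix.Norms.L2Operator in
lemma isOpenPosMeasure_multivariateGaussian (m : EuclideanSpace ℝ ι) {S : Matrix ι ι ℝ}
    (hS : S.PosDef) : (multivariateGaussian m S).IsOpenPosMeasure := by
  have := isOpenPosMeasure_stdGaussian (ι := ι)
  have hu : IsUnit (CFC.sqrt S) :=
    (CFC.isUnit_sqrt_iff S hS.posSemidef.nonneg).2 hS.isUnit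
  refine isOpenPosMeasure_map (by fun_prop) ?_
  obtain ⟨u, hu⟩ := hu
  intro y
  refine ⟨Matrix.toEuclideanCLM (𝕜 := ℝ) (↑u⁻¹ : Matrix ι ι ℝ) (y - m), ?_⟩
  have h : Matrix.toEuclideanCLM (𝕜 := ℝ) (u : Matrix ι ι ℝ) *
      Matrix.toEuclideanCLM (𝕜 := ℝ) (↑u⁻¹ : Matrix ι ι ℝ) = 1 := by
    rw [← map_mul, Units.mul_inv, map_one]
  have h' : Matrix.toEuclideanCLM (𝕜 := ℝ) (u : Matrix ι ι ℝ)
      (Matrix.toEuclideanCLM (𝕜 := ℝ) (↑u⁻¹ : Matrix ι ι ℝ) (y - m)) = y - m :=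
    DFunLike.congr_fun h _
  dsimp only
  rw [← hu, h']
  abel

/-- A Gaussian vector with invertible covariance matrix has full support. -/
lemma isOpenPosMeasure_of_hasGaussianLaw {T : ι → Ω → ℝ}
    (hT : HasGaussianLaw (fun ω i => T i ω) P) {S : Matrix ι ι ℝ} (hS : S.PosDef)
    (hcov : ∀ i j, cov[T i, T j; P] = S i j) :
    (P.map fun ω i => T i ω).IsOpenPosMeasure := by
  have := hT.isProbabilityMeasure
  have hL : HasGaussianLaw (fun ω => WithLp.toLp 2 (fun i => T i ω)) P := hT.toLp_pi 2
  set m : EuclideanSpace ℝ ι := ∫ x, x ∂(P.map fun ω => WithLp.toLp 2 (fun i => T i ω)) with hm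
  -- A Gaussian law is determined by its mean and covariance form, and the latter is compared on the
  -- standard basis.
  have hlaw : P.map (fun ω => WithLp.toLp 2 (fun i => T i ω)) = multivariateGaussian m S := by
    have := hL.isGaussian_map
    apply IsGaussian.ext
    · simp [hm]
    rw [← ContinuousLinearMap.toBilinForm_inj]
    refine LinearMap.BilinForm.ext_basis (EuclideanSpace.basisFun ι ℝ).toBasis fun i j => ?_
    rw [ContinuousLinearMap.toBilinForm_apply, ContinuousLinearMap.toBilinForm_apply,
      covarianceBilin_multivariateGaussian hS.posSemidef,
      covarianceBilin_apply_eq_cov IsGaussian.memLp_two_id]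
    have hf (i : ι) : (fun x : EuclideanSpace ℝ ι =>
        inner ℝ ((EuclideanSpace.basisFun ι ℝ).toBasis i) x) = fun x => x i := by
      ext; simp [PiLp.inner_apply]
    rw [hf, hf, covariance_map (by fun_prop) (by fun_prop) hL.aemeasurable]
    simpa [Function.comp_def] using hcov i j
  have h2 : P.map (fun ω i => T i ω) = (multivariateGaussian m S).map WithLp.ofLp := by
    rw [← hlaw, AEMeasurable.map_map_of_aemeasurable (by fun_prop) hL.aemeasurable]
    rfl
  have := isOpenPosMeasure_multivariateGaussian m hS
  rw [h2]
  exact isOpenPosMeasure_map (PiLp.continuous_ofLp 2 _) (WithLp.ofLp_surjective 2)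

end Gaussian

/-! ### Conditional expectation given a right-censored observation. -/

section CensoredObservation

set_option linter.unusedSectionVars false

/-- Set integrals over `V ⁻¹' t` are set integrals over `t` for the image measure. This moves
conditional expectations from the joint posterior to the law of the latent vector. -/
lemma condExp_map_comp {Ω E : Type*} [MeasurableSpace Ω] {m mE : MeasurableSpace E} {Q : Measure Ω}
    [IsFiniteMeasure Q] {V : Ω → E} (hV : Measurable V) (hm : m ≤ mE)
    {G : E → ℝ} (hG : Integrable G (Q.map V)) :
    Q[G ∘ V | m.comap V] =ᵐ[Q] (Q.map V)[G | m] ∘ V := by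
  have hle : m.comap V ≤ ‹MeasurableSpace Ω› := (MeasurableSpace.comap_mono hm).trans hV.comap_le
  have hi : Integrable ((Q.map V)[G | m] ∘ V) Q := integrable_condExp.comp_measurable hV
  refine (ae_eq_condExp_of_forall_setIntegral_eq hle (hG.comp_measurable hV)
    (fun s _ _ => hi.integrableOn) ?_ ?_).symm
  · rintro _ ⟨t, ht, rfl⟩ _
    have h1 := setIntegral_condExp hm hG ht
    rwa [setIntegral_map (hm _ ht) integrable_condExp.aestronglyMeasurable hV.aemeasurable,
      setIntegral_map (hm _ ht) hG.aestronglyMeasurable hV.aemeasurable] at h1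
  · exact (stronglyMeasurable_condExp.comp_measurable (comap_measurable V)).aestronglyMeasurable

variable {E : Type*} [mE : MeasurableSpace E] {μ : Measure E} [IsProbabilityMeasure μ]

lemma setIntegral_cond {S t : Set E} (ht : MeasurableSet t)
    (F : E → ℝ) : ∫ w in t, F w ∂μ[|S] = (μ.real S)⁻¹ * ∫ w in t ∩ S, F w ∂μ := by
  rw [ProbabilityTheory.cond, Measure.restrict_smul, Measure.restrict_restrict ht,
    integral_smul_measure, ENNReal.toReal_inv, smul_eq_mul]
  rfl

lemma integral_cond {S : Set E}
    (F : E → ℝ) : ∫ w, F w ∂μ[|S] = (μ.real S)⁻¹ * ∫ w in S, F w ∂μ := by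
  simpa using setIntegral_cond MeasurableSet.univ F

lemma integral_eq_add_cond_compl {S : Set E} (hS : MeasurableSet S) (h0 : μ S ≠ 0) (h1 : μ Sᶜ ≠ 0)
    {F : E → ℝ} (hF : Integrable F μ) :
    ∫ w, F w ∂μ = (1 - μ.real S) * ∫ w, F w ∂μ[|Sᶜ] + μ.real S * ∫ w, F w ∂μ[|S] := by
  have h0' : μ.real S ≠ 0 := by simpa [measureReal_def, ENNReal.toReal_eq_zero_iff] using h0
  have h1' : μ.real Sᶜ ≠ 0 := by simpa [measureReal_def, ENNReal.toReal_eq_zero_iff] using h1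
  rw [integral_cond, integral_cond, ← probReal_compl_eq_one_sub hS,
    ← integral_add_compl hS hF, mul_inv_cancel_left₀ h0', mul_inv_cancel_left₀ h1', add_comm]

variable {y G : E → ℝ} {c : ℝ}

lemma measurable_censor (c : ℝ) : Measurable (censor c) :=
  Measurable.ite measurableSet_Ici measurable_const measurable_id

/-- Given a right-censored observation, the conditional expectation is the one given the full
observation where it is uncensored, and a constant where it is censored. -/
lemma condExp_comap_censor (hy : Measurable y) (hG : Integrable G μ)
    (hS : μ {w | c ≤ y w}ᶜ ≠ 0) (hN : μ {w | c ≤ y w} ≠ 0) :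
    μ[G | MeasurableSpace.comap (fun w => censor c (y w)) inferInstance] =ᵐ[μ]
      {w | c ≤ y w}.piecewise (fun _ => ∫ v, G v ∂μ[|{w | c ≤ y w}])
        (μ[|{w | c ≤ y w}ᶜ][G | MeasurableSpace.comap y inferInstance]) := by
  classical
  set N : Set E := {w | c ≤ y w} with hNdef
  have hNm : MeasurableSet N := measurableSet_le measurable_const hy
  have hμN : μ.real N ≠ 0 := by simpa [measureReal_def, ENNReal.toReal_eq_zero_iff] using hN
  have hμS : μ.real Nᶜ ≠ 0 := by simpa [measureReal_def, ENNReal.toReal_eq_zero_iff] using hS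
  set h := μ[|Nᶜ][G | MeasurableSpace.comap y inferInstance] with hh
  have hcens : Measurable fun w => censor c (y w) := (measurable_censor c).comp hy
  have hGS : Integrable G μ[|Nᶜ] := by
    rw [← memLp_one_iff_integrable] at hG ⊢; exact memLp_cond hG hS
  have hhN : IntegrableOn h Nᶜ μ := by
    have : Integrable h μ[|Nᶜ] := integrable_condExp
    rw [ProbabilityTheory.cond] at this
    exact (integrable_smul_measure (ENNReal.inv_ne_zero.2 (measure_ne_top _ _))
      (ENNReal.inv_ne_top.2 hS)).1 this
  set e := ∫ v, G v ∂μ[|N] with he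
  have hint : Integrable (N.piecewise (fun _ => e) h) μ :=
    Integrable.piecewise hNm integrableOn_const hhN
  refine (ae_eq_condExp_of_forall_setIntegral_eq hcens.comap_le hG
    (fun s _ _ => hint.integrableOn) ?_ ?_).symm
  · rintro _ ⟨B, hB, rfl⟩ -
    have hs : MeasurableSet ((fun w => censor c (y w)) ⁻¹' B) := hcens hB
    set s := (fun w => censor c (y w)) ⁻¹' B with hsdef
    rw [← integral_inter_add_sdiff hNm hint.integrableOn,
      ← integral_inter_add_sdiff hNm hG.integrableOn]
    congr 1
    · rw [setIntegral_congr_fun (hs.inter hNm) (g := fun _ => e)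
        (fun w hw => Set.piecewise_eq_of_mem _ _ _ hw.2)]
      -- On `N` the observation is constantly `c`, so an observable event meets `N` in all of `N` or
      -- in nothing.
      by_cases hc : c ∈ B
      · have : s ∩ N = N := by
          refine Set.inter_eq_right.2 fun w hw => ?_
          simp only [hsdef, Set.mem_preimage, censor, if_pos (show c ≤ y w from hw), hc]
        rw [this, setIntegral_const, he, integral_cond, smul_eq_mul,
          mul_inv_cancel_left₀ hμN]
      · have : s ∩ N = ∅ := by
          refine Set.eq_empty_of_forall_notMem fun w hw => hc ?_
          have := hw.1
          simpa only [hsdef, Set.mem_preimage, censor, if_pos (show c ≤ y w from hw.2)] using this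
        simp [this]
    -- Off `N` the observation is `y` itself, so the event is a `y`-event cut by `Nᶜ`, and the
    -- characterisation of `h` under `μ[|Nᶜ]` applies up to the factor `(μ.real Nᶜ)⁻¹`.
    · have hsN : s \ N = y ⁻¹' B ∩ Nᶜ := by
        ext w
        simp only [hsdef, hNdef, Set.mem_sdiff, Set.mem_preimage, Set.mem_ofPred_eq, censor,
          Set.mem_inter_iff, Set.mem_compl_iff]
        refine and_congr_left fun hw => ?_
        rw [if_neg hw]
      rw [setIntegral_congr_fun (hs.diff hNm) (g := h)
        (fun w hw => Set.piecewise_eq_of_notMem _ _ _ hw.2), hsN]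
      have h1 := setIntegral_condExp hy.comap_le hGS ⟨B, hB, rfl⟩
      rw [setIntegral_cond (hy hB), setIntegral_cond (hy hB)] at h1
      exact mul_left_cancel₀ (inv_ne_zero hμS) h1
  · have hsm : StronglyMeasurable[MeasurableSpace.comap y inferInstance] h :=
      stronglyMeasurable_condExp
    -- The censored value is at least `c` exactly on `N` and equals `y` elsewhere, so it determines
    -- both the piece and the value `φ y`.
    obtain ⟨φ, hφ, hφh⟩ := hsm.exists_eq_measurable_comp
    have : N.piecewise (fun _ => e) h =
        (fun t => if c ≤ t then e else φ t) ∘ fun w => censor c (y w) := by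
      ext w
      by_cases hw : c ≤ y w
      · rw [Set.piecewise_eq_of_mem N _ _ hw]
        simp [censor, hw]
      · rw [Set.piecewise_eq_of_notMem N _ _ hw, hφh]
        simp [censor, hw]
    rw [this]
    exact ((Measurable.ite measurableSet_Ici measurable_const
      hφ.measurable).comp (comap_measurable _)).stronglyMeasurable.aestronglyMeasurable

/-- Variance of a two-component mixture: the censored component is constant and has no internal
variance, leaving the variance within the uncensored component and the spread between the two means.
-/
lemma variance_condExp_comap_censor (hy : Measurable y) (hG : MemLp G 2 μ)
    (hS : μ {w | c ≤ y w}ᶜ ≠ 0) (hN : μ {w | c ≤ y w} ≠ 0) :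
    Var[μ[G | MeasurableSpace.comap (fun w => censor c (y w)) inferInstance]; μ] =
      (1 - μ.real {w | c ≤ y w}) *
        Var[μ[|{w | c ≤ y w}ᶜ][G | MeasurableSpace.comap y inferInstance];
          μ[|{w | c ≤ y w}ᶜ]] +
      μ.real {w | c ≤ y w} * (1 - μ.real {w | c ≤ y w}) *
        (∫ w, G w ∂μ[|{w | c ≤ y w}] - ∫ w, G w ∂μ[|{w | c ≤ y w}ᶜ]) ^ 2 := by
  set N : Set E := {w | c ≤ y w} with hNdef
  have hNm : MeasurableSet N := measurableSet_le measurable_const hy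
  have := cond_isProbabilityMeasure hS
  have := cond_isProbabilityMeasure hN
  set h := μ[|Nᶜ][G | MeasurableSpace.comap y inferInstance] with hh
  set g := μ[G | MeasurableSpace.comap (fun w => censor c (y w)) inferInstance] with hg
  set e := ∫ v, G v ∂μ[|N] with he
  have hgae : g =ᵐ[μ] N.piecewise (fun _ => e) h :=
    condExp_comap_censor hy (hG.integrable one_le_two) hS hN
  have hg2 : MemLp g 2 μ := hG.condExp one_le_two
  have hh2 : MemLp h 2 μ[|Nᶜ] := (memLp_cond hG hS).condExp one_le_two
  have hgN : g =ᵐ[μ[|N]] fun _ => e := by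
    filter_upwards [cond_absolutelyContinuous.ae_le hgae, ae_cond_mem hNm] with w hw hwN
    rw [hw, Set.piecewise_eq_of_mem _ _ _ hwN]
  have hgS : g =ᵐ[μ[|Nᶜ]] h := by
    filter_upwards [cond_absolutelyContinuous.ae_le hgae, ae_cond_mem hNm.compl] with w hw hwN
    rw [hw, Set.piecewise_eq_of_notMem _ _ _ hwN]
  have hmean : ∫ w, h w ∂μ[|Nᶜ] = ∫ w, G w ∂μ[|Nᶜ] := integral_condExp hy.comap_le
  have i1 : ∫ w, g w ∂μ[|N] = e := by rw [integral_congr_ae hgN]; simp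
  have i2 : ∫ w, g w ^ 2 ∂μ[|N] = e ^ 2 := by
    rw [integral_congr_ae (g := fun _ => e ^ 2) (by filter_upwards [hgN] with w hw; rw [hw])]
    simp
  have i3 : ∫ w, g w ∂μ[|Nᶜ] = ∫ w, h w ∂μ[|Nᶜ] := integral_congr_ae hgS
  have i4 : ∫ w, g w ^ 2 ∂μ[|Nᶜ] = ∫ w, h w ^ 2 ∂μ[|Nᶜ] :=
    integral_congr_ae (by filter_upwards [hgS] with w hw; rw [hw])
  rw [variance_eq_sub hg2, variance_eq_sub hh2]
  simp only [Pi.pow_apply]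
  rw [integral_eq_add_cond_compl hNm hN hS hg2.integrable_sq,
    integral_eq_add_cond_compl hNm hN hS (hg2.integrable one_le_two), i1, i2, i3, i4, hmean]
  ring

end CensoredObservation

/-! ### Conditional variances of linear combinations. -/

section LinearFunctional

set_option linter.unusedSectionVars false

variable {E ι : Type*} {m : MeasurableSpace E} [mE : MeasurableSpace E] [Fintype ι] {μ : Measure E}
  [IsProbabilityMeasure μ] {X : ι → E → ℝ} (b : ι → ℝ)

lemma variance_sum_mul (hX : ∀ i, MemLp (X i) 2 μ) :
    Var[fun w => ∑ i, b i * X i w; μ] = ∑ i, ∑ j, b i * b j * cov[X i, X j; μ] := by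
  rw [variance_fun_sum fun i => (hX i).const_mul (b i)]
  refine Finset.sum_congr rfl fun i _ => Finset.sum_congr rfl fun j _ => ?_
  rw [covariance_const_mul_left, covariance_const_mul_right, mul_assoc]

lemma condExp_sum_mul (hX : ∀ i, Integrable (X i) μ) :
    μ[fun w => ∑ i, b i * X i w | m] =ᵐ[μ] fun w => ∑ i, b i * (μ[X i | m]) w := by
  have h1 : (fun w => ∑ i, b i * X i w) = ∑ i, b i • X i := by ext w; simp
  rw [h1]
  refine (condExp_finsetSum (fun i _ => (hX i).smul (b i)) m).trans ?_
  have h2 : ∀ᵐ w ∂μ, ∀ i, (μ[b i • X i | m]) w = (b i • μ[X i | m]) w :=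
    ae_all_iff.2 fun i => condExp_smul (b i) (X i) m
  filter_upwards [h2] with w hw
  simp [Finset.sum_apply, hw]

/-- Variance of the conditional expectation of a linear combination, in terms of the covariances
and of the expected conditional covariances. -/
lemma variance_condExp_sum_mul (hX : ∀ i, MemLp (X i) 2 μ) (hm : m ≤ mE) :
    Var[μ[fun w => ∑ i, b i * X i w | m]; μ] =
      ∑ i, ∑ j, b i * b j * (cov[X i, X j; μ] -
        ∫ w, (X i w - (μ[X i | m]) w) * (X j w - (μ[X j | m]) w) ∂μ) := by
  have hG : MemLp (fun w => ∑ i, b i * X i w) 2 μ :=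
    memLp_finsetSum _ fun i _ => (hX i).const_mul (b i)
  have hres (i : ι) : MemLp (fun w => X i w - (μ[X i | m]) w) 2 μ :=
    (hX i).sub ((hX i).condExp one_le_two)
  -- The expected conditional variance is the mean square of the residual, which is linear in the
  -- residuals of the `X i`. Total variance then gives the claim.
  have key : ∫ w, (Var[fun w => ∑ i, b i * X i w; μ | m]) w ∂μ =
      ∑ i, ∑ j, b i * b j * ∫ w, (X i w - (μ[X i | m]) w) * (X j w - (μ[X j | m]) w) ∂μ := by
    rw [condVar, integral_condExp hm]
    have : ((fun w => ∑ i, b i * X i w) - μ[fun w => ∑ i, b i * X i w | m]) ^ 2 =ᵐ[μ]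
        fun w => ∑ i, ∑ j, b i * b j *
          ((X i w - (μ[X i | m]) w) * (X j w - (μ[X j | m]) w)) := by
      filter_upwards [condExp_sum_mul b (fun i => (hX i).integrable one_le_two) (m := m)] with w hw
      rw [Pi.pow_apply, Pi.sub_apply, hw, ← Finset.sum_sub_distrib, sq, Finset.sum_mul_sum]
      refine Finset.sum_congr rfl fun i _ => Finset.sum_congr rfl fun j _ => ?_
      ring
    have hint (i j : ι) : Integrable (fun w => b i * b j *
        ((X i w - (μ[X i | m]) w) * (X j w - (μ[X j | m]) w))) μ :=
      ((hres i).integrable_mul (hres j)).const_mul _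
    rw [integral_congr_ae this, integral_finsetSum _ fun i _ =>
      integrable_finsetSum _ fun j _ => hint i j]
    refine Finset.sum_congr rfl fun i _ => ?_
    rw [integral_finsetSum _ fun j _ => hint i j]
    refine Finset.sum_congr rfl fun j _ => ?_
    rw [integral_const_mul]
  have htot := integral_condVar_add_variance_condExp hm hG
  rw [key, variance_sum_mul b hX] at htot
  rw [← eq_sub_iff_add_eq'] at htot
  rw [htot, ← Finset.sum_sub_distrib]
  refine Finset.sum_congr rfl fun i _ => ?_
  rw [← Finset.sum_sub_distrib]
  refine Finset.sum_congr rfl fun j _ => ?_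
  ring

end LinearFunctional

/-! ### The expected conditional variance given a censored coordinate. -/

section ExpectedConditionalVariance

variable {Ω ι : Type*} [mΩ : MeasurableSpace Ω] [Fintype ι] {Q : Measure Ω}
  [IsProbabilityMeasure Q] {X R : Ω → ℝ} {V : Ω → ι → ℝ} (b : ι → ℝ) (k : ℝ) (n : ι) (c : ℝ)

/-- Expected conditional variance, given a censored coordinate of `V`, of a response that is a
linear function of `V` up to an independent error. -/
theorem integral_condVar_comap_censor (hV : Measurable V) (hR : Measurable R)
    (hX : X = fun w => k + ∑ l, b l * V w l + R w) (hind : IndepFun R V Q)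
    (hR2 : MemLp R 2 Q) (hV2 : ∀ l, MemLp (fun w => V w l) 2 Q)
    {μ ν ν' : Measure (ι → ℝ)} (hμ : Q.map V = μ)
    (hS : μ {v | c ≤ v n}ᶜ ≠ 0) (hN : μ {v | c ≤ v n} ≠ 0)
    (hν : μ[|{v | c ≤ v n}ᶜ] = ν) (hν' : μ[|{v | c ≤ v n}] = ν') :
    ∫ w, (Var[X; Q | MeasurableSpace.comap (fun w => censor c (V w n)) inferInstance]) w ∂Q =
      Var[X; Q] -
      ((1 - μ.real {v | c ≤ v n}) *
        ∑ i, ∑ j, b i * b j * (cov[fun v => v i, fun v => v j; ν] -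
          ∫ v, (v i - (ν[fun v => v i |
              MeasurableSpace.comap (fun v : ι → ℝ => v n) inferInstance]) v) *
            (v j - (ν[fun v => v j |
              MeasurableSpace.comap (fun v : ι → ℝ => v n) inferInstance]) v) ∂ν) +
      μ.real {v | c ≤ v n} * (1 - μ.real {v | c ≤ v n}) *
        (∑ l, b l * (∫ v, v l ∂ν' - ∫ v, v l ∂ν)) ^ 2) := by
  have : IsProbabilityMeasure μ := hμ ▸ Measure.isProbabilityMeasure_map hV.aemeasurable
  set G : (ι → ℝ) → ℝ := fun v => ∑ l, b l * v l with hGdef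
  have hGm : Measurable G := by fun_prop
  have hl (l : ι) : MemLp (fun v : ι → ℝ => v l) 2 μ := by
    rw [← hμ, memLp_map_measure_iff (measurable_pi_apply l).aestronglyMeasurable hV.aemeasurable]
    exact hV2 l
  have hG : MemLp G 2 μ := memLp_finsetSum _ fun l _ => (hl l).const_mul (b l)
  have hGV : MemLp (G ∘ V) 2 Q := memLp_finsetSum _ fun l _ => (hV2 l).const_mul (b l)
  have hX2 : MemLp X 2 Q := by
    rw [hX]
    exact ((memLp_const k).add hGV).add hR2
  have hcy : Measurable fun v : ι → ℝ => censor c (v n) :=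
    (measurable_censor c).comp (measurable_pi_apply n)
  have hcV : Measurable fun w => censor c (V w n) := hcy.comp hV
  have hk : Integrable (fun _ : Ω => k) Q := integrable_const k
  have hGi : Integrable (G ∘ V) Q := hGV.integrable one_le_two
  have hRi : Integrable R Q := hR2.integrable one_le_two
  have hkG : Integrable ((fun _ : Ω => k) + G ∘ V) Q := hk.add hGi
  -- The error is independent of `V`, hence of the censored coordinate, and contributes only a
  -- constant to the conditional mean.
  have hRm : Q[R | MeasurableSpace.comap (fun w => censor c (V w n)) inferInstance] =ᵐ[Q] fun _ => ∫ w, R w ∂Q := by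
    refine condExp_indep_eq (m₁ := MeasurableSpace.comap R inferInstance) hR.comap_le
      hcV.comap_le (comap_measurable R).stronglyMeasurable ?_
    exact hind.comp measurable_id hcy
  set g := μ[G | MeasurableSpace.comap (fun v : ι → ℝ => censor c (v n)) inferInstance] with hg
  have hgV : Q[G ∘ V | MeasurableSpace.comap (fun w => censor c (V w n)) inferInstance] =ᵐ[Q]
      g ∘ V := by
    have := condExp_map_comp (Q := Q) hV hcy.comap_le (G := G)
      (by rw [hμ]; exact hG.integrable one_le_two)
    rwa [MeasurableSpace.comap_comp, hμ] at this
  set m := MeasurableSpace.comap (fun w => censor c (V w n)) inferInstance with hm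
  have hcond : Q[X | m] =ᵐ[Q] fun w => (k + ∫ w, R w ∂Q) + g (V w) := by
    have e1 : X = ((fun _ => k) + G ∘ V) + R := hX
    have h1 := condExp_add hkG hRi m
    have h2 := condExp_add hk hGi m
    rw [e1]
    filter_upwards [h1, h2, hgV, hRm] with w h1 h2 h3 h4
    rw [h1, Pi.add_apply, h2, Pi.add_apply, h3, h4, condExp_const hcV.comap_le]
    simp only [Function.comp_apply]
    ring
  have hgm : StronglyMeasurable g := stronglyMeasurable_condExp.mono hcy.comap_le
  have hvar : Var[Q[X | m]; Q] = Var[g; μ] := by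
    rw [variance_congr hcond, variance_const_add (X := fun w => g (V w)) (hgm.comp_measurable hV).aestronglyMeasurable,
      ← hμ, variance_map hgm.measurable.aemeasurable hV.aemeasurable]
    rfl
  -- Total variance leaves only the variance of the conditional mean, which has been moved to the
  -- law `μ` of `V`.
  have htot := integral_condVar_add_variance_condExp hcV.comap_le hX2
  rw [← hm, hvar, ← eq_sub_iff_add_eq] at htot
  rw [htot, variance_condExp_comap_censor (measurable_pi_apply n) hG hS hN]
  have hlS (l : ι) : MemLp (fun v : ι → ℝ => v l) 2 ν := hν ▸ memLp_cond (hl l) hS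
  have hlN (l : ι) : MemLp (fun v : ι → ℝ => v l) 2 ν' := hν' ▸ memLp_cond (hl l) hN
  rw [hν, hν']
  have : IsProbabilityMeasure ν := hν ▸ cond_isProbabilityMeasure hS
  have : IsProbabilityMeasure ν' := hν' ▸ cond_isProbabilityMeasure hN
  rw [variance_condExp_sum_mul b hlS (measurable_pi_apply n).comap_le,
    integral_finsetSum _ fun l _ => ((hlS l).integrable one_le_two).const_mul (b l),
    integral_finsetSum _ fun l _ => ((hlN l).integrable one_le_two).const_mul (b l)]
  simp only [integral_const_mul, ← Finset.sum_sub_distrib, ← mul_sub]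

end ExpectedConditionalVariance

/-! ### Linear regression and independence for Gaussian vectors. -/

section Regression

variable {Ω ι κ κ' : Type*} [MeasurableSpace Ω] [Fintype ι] [Finite κ] [Finite κ']
  {P : Measure Ω} {Z : ι → Ω → ℝ}

lemma memLp_of_mem_span (hZ : ∀ i, MemLp (Z i) 2 P) {X : Ω → ℝ}
    (hX : X ∈ Submodule.span ℝ (Set.range Z)) : MemLp X 2 P := by
  obtain ⟨c, rfl⟩ := (Submodule.mem_span_range_iff_exists_fun ℝ).1 hX
  exact memLp_finsetSum' _ fun i _ => (hZ i).const_smul (c i)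

/-- Linear combinations of a Gaussian vector are jointly Gaussian, so vanishing cross-covariances
imply independence. -/
lemma indepFun_of_mem_span (hZ : HasGaussianLaw (fun ω i => Z i ω) P)
    {X : κ → Ω → ℝ} {Y : κ' → Ω → ℝ}
    (hX : ∀ k, X k ∈ Submodule.span ℝ (Set.range Z))
    (hY : ∀ k, Y k ∈ Submodule.span ℝ (Set.range Z))
    (h : ∀ k l, cov[X k, Y l; P] = 0) :
    IndepFun (fun ω k => X k ω) (fun ω l => Y l ω) P := by
  have := Fintype.ofFinite κ
  have := Fintype.ofFinite κ'
  choose C hC using fun k => (Submodule.mem_span_range_iff_exists_fun ℝ).1 (hX k)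
  choose D hD using fun k => (Submodule.mem_span_range_iff_exists_fun ℝ).1 (hY k)
  refine HasGaussianLaw.indepFun_of_covariance_eval ?_ h
  let L : (ι → ℝ) →ₗ[ℝ] (κ → ℝ) × (κ' → ℝ) :=
    (Matrix.mulVecLin (Matrix.of C)).prod (Matrix.mulVecLin (Matrix.of D))
  have e : (fun ω => (fun k => X k ω, fun l => Y l ω)) =
      fun ω => L.toContinuousLinearMap fun i => Z i ω := by
    funext ω
    refine Prod.ext (funext fun k => ?_) (funext fun k => ?_)
    · simp [L, ← hC, Matrix.mulVec, dotProduct]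
    · simp [L, ← hD, Matrix.mulVec, dotProduct]
  rw [e]
  exact hZ.map_fun L.toContinuousLinearMap

variable [DecidableEq ι] [IsProbabilityMeasure P] {Y : Ω → ℝ} {K : Matrix ι ι ℝ} {k : ι → ℝ}

/-- Error of the linear regression of `Y` on `Z`. -/
lemma covariance_sub_sum_inv_mulVec (hZ : ∀ i, MemLp (Z i) 2 P) (hY : MemLp Y 2 P)
    (hK : ∀ i j, cov[Z i, Z j; P] = K i j) (hk : ∀ i, cov[Z i, Y; P] = k i)
    (hu : IsUnit K.det) (j : ι) :
    cov[fun ω => Y ω - ∑ i, (K⁻¹ *ᵥ k) i * Z i ω, Z j; P] = 0 := by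
  have hs : MemLp (fun ω => ∑ i, (K⁻¹ *ᵥ k) i * Z i ω) 2 P :=
    memLp_finsetSum _ fun i _ => (hZ i).const_mul _
  rw [covariance_fun_sub_left hY hs (hZ j),
    covariance_fun_sum_left (fun i => (hZ i).const_mul _) (hZ j), covariance_comm, hk]
  simp_rw [covariance_const_mul_left]
  have h1 : ∑ i, (K⁻¹ *ᵥ k) i * cov[Z i, Z j; P] = (K *ᵥ (K⁻¹ *ᵥ k)) j := by
    simp only [Matrix.mulVec, dotProduct]
    refine Finset.sum_congr rfl fun i _ => ?_
    rw [covariance_comm, hK, mul_comm]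
  rw [h1, Matrix.mulVec_mulVec, Matrix.mul_nonsing_inv _ hu, Matrix.one_mulVec, sub_self]

/-- The error is orthogonal to the predictor, so its variance equals its covariance with `Y`. -/
lemma variance_sub_sum_inv_mulVec (hZ : ∀ i, MemLp (Z i) 2 P) (hY : MemLp Y 2 P)
    (hK : ∀ i j, cov[Z i, Z j; P] = K i j) (hk : ∀ i, cov[Z i, Y; P] = k i)
    (hu : IsUnit K.det) :
    Var[fun ω => Y ω - ∑ i, (K⁻¹ *ᵥ k) i * Z i ω; P] = Var[Y; P] - k ⬝ᵥ (K⁻¹ *ᵥ k) := by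
  have hs : MemLp (fun ω => ∑ i, (K⁻¹ *ᵥ k) i * Z i ω) 2 P :=
    memLp_finsetSum _ fun i _ => (hZ i).const_mul _
  have hR : MemLp (fun ω => Y ω - ∑ i, (K⁻¹ *ᵥ k) i * Z i ω) 2 P := hY.sub hs
  have h0 : cov[fun ω => Y ω - ∑ i, (K⁻¹ *ᵥ k) i * Z i ω,
      fun ω => ∑ i, (K⁻¹ *ᵥ k) i * Z i ω; P] = 0 := by
    rw [covariance_fun_sum_right (fun i => (hZ i).const_mul _) hR]
    simp_rw [covariance_const_mul_right, covariance_sub_sum_inv_mulVec hZ hY hK hk hu]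
    simp
  rw [← covariance_self hR.aemeasurable, covariance_fun_sub_right hR hY hs, h0, sub_zero,
    covariance_fun_sub_left hY hs hY, covariance_self hY.aemeasurable,
    covariance_fun_sum_left (fun i => (hZ i).const_mul _) hY]
  simp_rw [covariance_const_mul_left, hk]
  rw [dotProduct_comm]
  rfl

end Regression

namespace Experiment

/-! ### Covariances and joint Gaussianity of the model. -/

section ModelCovariance

set_option linter.unusedSectionVars false

variable {p nf no nc : ℕ} {S : Experiment p nf no nc} {Ω : Type*} [MeasurableSpace Ω]
  {f δ : Input p → Ω → ℝ} {ε : Phys no nc → Ω → ℝ} {P : Measure Ω} [IsProbabilityMeasure P]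

variable (S f δ ε) in
/-- The responses of all runs, without censoring: computer outputs, then physical responses. -/
def runs (xnext : Input p) : Fin nf ⊕ Phys no nc → Ω → ℝ :=
  Sum.elim (fun i => f (S.xF i)) (S.response f δ ε xnext)

lemma IsModel.hasGaussianLaw_noise (h : S.IsModel f δ ε P) (q : Phys no nc) :
    HasGaussianLaw (ε q) P := by
  constructor
  rw [h.noise_law]
  infer_instance

lemma IsModel.memLp_f (h : S.IsModel f δ ε P) (x : Input p) : MemLp (f x) 2 P :=
  (h.gpF.gaussian.hasGaussianLaw_eval x).memLp_two

lemma IsModel.memLp_delta (h : S.IsModel f δ ε P) (x : Input p) : MemLp (δ x) 2 P :=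
  (h.gpD.gaussian.hasGaussianLaw_eval x).memLp_two

lemma IsModel.memLp_noise (h : S.IsModel f δ ε P) (q : Phys no nc) : MemLp (ε q) 2 P :=
  (h.hasGaussianLaw_noise q).memLp_two

lemma IsModel.memLp_xi (h : S.IsModel f δ ε P) (x : Input p) : MemLp (xi f δ x) 2 P :=
  (h.memLp_f x).add (h.memLp_delta x)

lemma IsModel.memLp_response (h : S.IsModel f δ ε P) (xnext : Input p) (q : Phys no nc) :
    MemLp (S.response f δ ε xnext q) 2 P :=
  (h.memLp_xi _).add (h.memLp_noise q)

lemma IsModel.memLp_runs (h : S.IsModel f δ ε P) (xnext : Input p) (i : Fin nf ⊕ Phys no nc) :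
    MemLp (S.runs f δ ε xnext i) 2 P := by
  cases i
  · exact h.memLp_f _
  · exact h.memLp_response _ _

lemma IsModel.cov_f_delta (h : S.IsModel f δ ε P) (x y : Input p) : cov[f x, δ y; P] = 0 :=
  (h.indep_f_delta.comp (measurable_pi_apply x) (measurable_pi_apply y)).covariance_eq_zero
    (h.memLp_f x) (h.memLp_delta y)

lemma IsModel.cov_f_noise (h : S.IsModel f δ ε P) (x : Input p) (q : Phys no nc) :
    cov[f x, ε q; P] = 0 :=
  (h.indep_noise.comp ((measurable_pi_apply x).comp measurable_fst)
    (measurable_pi_apply q)).covariance_eq_zero (h.memLp_f x) (h.memLp_noise q)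

lemma IsModel.cov_delta_noise (h : S.IsModel f δ ε P) (x : Input p) (q : Phys no nc) :
    cov[δ x, ε q; P] = 0 :=
  (h.indep_noise.comp ((measurable_pi_apply x).comp measurable_snd)
    (measurable_pi_apply q)).covariance_eq_zero (h.memLp_delta x) (h.memLp_noise q)

lemma IsModel.cov_noise (h : S.IsModel f δ ε P) (q r : Phys no nc) :
    cov[ε q, ε r; P] = S.varE * (1 : Matrix (Phys no nc) (Phys no nc) ℝ) q r := by
  by_cases hqr : q = r
  · subst hqr
    have hm := (h.memLp_noise q).aemeasurable
    have := variance_map (X := id) (μ := P) (Y := ε q) aemeasurable_id hm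
    rw [h.noise_law, variance_id_gaussianReal] at this
    rw [covariance_self hm, Matrix.one_apply_eq, mul_one, this]
    rfl
  · rw [Matrix.one_apply_ne hqr, mul_zero]
    exact (h.noise_indep.indepFun hqr).covariance_eq_zero (h.memLp_noise q) (h.memLp_noise r)

lemma IsModel.cov_f_xi (h : S.IsModel f δ ε P) (x y : Input p) :
    cov[f x, xi f δ y; P] = S.varF * S.corrF x y := by
  have : xi f δ y = f y + δ y := rfl
  rw [this, covariance_add_right (h.memLp_f x) (h.memLp_f y) (h.memLp_delta y), h.gpF.cov,
    h.cov_f_delta, add_zero]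

lemma IsModel.cov_xi_xi (h : S.IsModel f δ ε P) (x y : Input p) :
    cov[xi f δ x, xi f δ y; P] = S.varF * S.corrF x y + S.varD * S.corrD x y := by
  have hx : xi f δ x = f x + δ x := rfl
  have hy : xi f δ y = f y + δ y := rfl
  rw [hx, covariance_add_left (h.memLp_f x) (h.memLp_delta x) (h.memLp_xi y), h.cov_f_xi, hy,
    covariance_add_right (h.memLp_delta x) (h.memLp_f y) (h.memLp_delta y), h.gpD.cov,
    covariance_comm, h.cov_f_delta, zero_add]

lemma IsModel.cov_xi_noise (h : S.IsModel f δ ε P) (x : Input p) (q : Phys no nc) :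
    cov[xi f δ x, ε q; P] = 0 := by
  have hx : xi f δ x = f x + δ x := rfl
  rw [hx, covariance_add_left (h.memLp_f x) (h.memLp_delta x) (h.memLp_noise q), h.cov_f_noise,
    h.cov_delta_noise, add_zero]

lemma IsModel.variance_xi (h : S.IsModel f δ ε P) (x : Input p) :
    Var[xi f δ x; P] = S.varF + S.varD := by
  rw [← covariance_self (h.memLp_xi x).aemeasurable, h.cov_xi_xi, h.corrF.diag, h.corrD.diag,
    mul_one, mul_one]

lemma response_eq_add (xnext : Input p) (q : Phys no nc) :
    S.response f δ ε xnext q = xi f δ (S.xPhys xnext q) + ε q := rfl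

lemma IsModel.cov_runs_xi (h : S.IsModel f δ ε P) (xnext x : Input p)
    (i : Fin nf ⊕ Phys no nc) :
    cov[S.runs f δ ε xnext i, xi f δ x; P] = S.crossCov (S.xPhys xnext) x i := by
  rcases i with i | q
  · simp only [runs, Sum.elim_inl, crossCov, Pi.add_apply, Pi.smul_apply, smul_eq_mul, mul_zero,
      add_zero]
    exact h.cov_f_xi _ _
  · simp only [runs, Sum.elim_inr, crossCov, Pi.add_apply, Pi.smul_apply, smul_eq_mul]
    rw [response_eq_add, covariance_add_left (h.memLp_xi _) (h.memLp_noise q) (h.memLp_xi x),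
      h.cov_xi_xi, covariance_comm, h.cov_xi_noise, add_zero]

lemma IsModel.cov_runs_runs (h : S.IsModel f δ ε P) (xnext : Input p)
    (i j : Fin nf ⊕ Phys no nc) :
    cov[S.runs f δ ε xnext i, S.runs f δ ε xnext j; P] = S.gram (S.xPhys xnext) i j := by
  have hfr (x : Input p) (r : Phys no nc) : cov[f x, S.response f δ ε xnext r; P] =
      S.varF * S.corrF x (S.xPhys xnext r) := by
    rw [response_eq_add, covariance_add_right (h.memLp_f _) (h.memLp_xi _) (h.memLp_noise r),
      h.cov_f_xi, h.cov_f_noise, add_zero]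
  rcases i with i | q <;> rcases j with j | r
  · simp [runs, gram, h.gpF.cov]
  · simp [runs, gram, hfr]
  · simp [runs, gram, covariance_comm (S.response f δ ε xnext q), hfr, h.corrF.symm]
  · simp only [runs, Sum.elim_inr, gram, Matrix.add_apply, Matrix.smul_apply, Matrix.of_apply,
      smul_eq_mul, Matrix.fromBlocks_apply₂₂]
    rw [response_eq_add, response_eq_add,
      covariance_add_left (h.memLp_xi _) (h.memLp_noise q) ((h.memLp_xi _).add (h.memLp_noise r)),
      covariance_add_right (h.memLp_xi _) (h.memLp_xi _) (h.memLp_noise r),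
      covariance_add_right (h.memLp_noise q) (h.memLp_xi _) (h.memLp_noise r),
      h.cov_xi_xi, h.cov_xi_noise, h.cov_noise, covariance_comm, h.cov_xi_noise]
    ring

/-- The process is first reindexed by `ι`, since the inputs `x i` may repeat. -/
lemma hasGaussianLaw_of_finite {T ι : Type*} [Fintype ι] {X : T → Ω → ℝ}
    (hX : IsGaussianProcess X P) (x : ι → T) : HasGaussianLaw (fun ω i => X (x i) ω) P := by
  classical
  let L : (↥(Finset.univ : Finset ι) → ℝ) →L[ℝ] (ι → ℝ) :=
    ContinuousLinearMap.pi fun i => ContinuousLinearMap.proj ⟨i, Finset.mem_univ i⟩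
  exact ((hX.comp_right x).hasGaussianLaw Finset.univ).map_fun L

variable (S f δ ε) in
/-- The mean physical response at `x` together with the responses of all runs. -/
def jointVec (xnext x : Input p) (i : Option (Fin nf ⊕ Phys no nc)) (ω : Ω) : ℝ :=
  i.elim (xi f δ x ω) fun i => S.runs f δ ε xnext i ω

/-- The values of `f`, those of `δ` and the noise are independent Gaussian vectors, hence jointly
Gaussian, and the family is a linear image of them. -/
lemma IsModel.hasGaussianLaw_jointVec (h : S.IsModel f δ ε P) (xnext x : Input p) :
    HasGaussianLaw (fun ω i => S.jointVec f δ ε xnext x i ω) P := by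
  let z : Option (Fin nf ⊕ Phys no nc) → Input p :=
    fun i => i.elim x (Sum.elim S.xF (S.xPhys xnext))
  have hF := hasGaussianLaw_of_finite h.gpF.gaussian z
  have hD := hasGaussianLaw_of_finite h.gpD.gaussian z
  have hE : HasGaussianLaw (fun ω q => ε q ω) P :=
    h.noise_indep.hasGaussianLaw h.hasGaussianLaw_noise
  have hr : Measurable fun (g : Input p → ℝ) i => g (z i) :=
    measurable_pi_lambda _ fun i => measurable_pi_apply (z i)
  have hFD := IndepFun.hasGaussianLaw hF hD (h.indep_f_delta.comp hr hr)
  have hFDE := IndepFun.hasGaussianLaw hFD hE (h.indep_noise.comp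
    ((hr.comp measurable_fst).prodMk (hr.comp measurable_snd)) measurable_id)
  let L : (((Option (Fin nf ⊕ Phys no nc)) → ℝ) × ((Option (Fin nf ⊕ Phys no nc)) → ℝ)) ×
      (Phys no nc → ℝ) →ₗ[ℝ] (Option (Fin nf ⊕ Phys no nc) → ℝ) :=
    { toFun := fun g i => i.elim (g.1.1 none + g.1.2 none)
        (Sum.elim (fun i => g.1.1 (some (.inl i)))
          fun q => g.1.1 (some (.inr q)) + g.1.2 (some (.inr q)) + g.2 q)
      map_add' := by
        intro g g'
        ext i
        rcases i with _ | i | q <;> simp <;> ring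
      map_smul' := by
        intro c g
        ext i
        rcases i with _ | i | q <;> simp <;> ring }
  have e : (fun ω i => S.jointVec f δ ε xnext x i ω) =
      fun ω => L.toContinuousLinearMap
        ((fun i => f (z i) ω, fun i => δ (z i) ω), fun q => ε q ω) := by
    funext ω i
    rcases i with _ | i | q <;> rfl
  rw [e]
  exact hFDE.map_fun L.toContinuousLinearMap

end ModelCovariance

end Experiment

/-! ### A linear response with independent error, after conditioning. -/

section LinearResponse

set_option linter.unusedSectionVars false

variable {Ω ι γ : Type*} [MeasurableSpace Ω] [Fintype ι] [MeasurableSpace γ] {P : Measure Ω}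
  [IsProbabilityMeasure P]

lemma indepFun_map {α β β' : Type*} [MeasurableSpace α] [MeasurableSpace β] [MeasurableSpace β']
    {Φ : Ω → α} (hΦ : AEMeasurable Φ P) {F : α → β} {G : α → β'} (hF : Measurable F)
    (hG : Measurable G) (h : IndepFun (F ∘ Φ) (G ∘ Φ) P) : IndepFun F G (P.map Φ) := by
  rw [indepFun_iff_measure_inter_preimage_eq_mul] at h ⊢
  intro s t hs ht
  rw [Measure.map_apply_of_aemeasurable hΦ ((hF hs).inter (hG ht)),
    Measure.map_apply_of_aemeasurable hΦ (hF hs), Measure.map_apply_of_aemeasurable hΦ (hG ht)]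
  exact h s t hs ht

/-- Conditioning on a function of the regressors does not change the law of an error that is
independent of that function. -/
lemma residual_cond {b : ι → ℝ} {k : ℝ} {R : Ω → ℝ} {L : ι → Ω → ℝ} {φ : Ω → ℝ × (ι → ℝ)}
    (hφ : φ = fun ω => (R ω + k + ∑ l, b l * L l ω, fun l => L l ω))
    (hR : MemLp R 2 P) (hL : ∀ l, AEMeasurable (L l) P) {V : (ι → ℝ) → γ} (hV : Measurable V)
    (hind : IndepFun R (fun ω => V fun l => L l ω) P) {B : Set γ} (hB : MeasurableSet B)
    (hne : P.map (fun ω l => L l ω) (V ⁻¹' B) ≠ 0) :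
    IndepFun (fun w : ℝ × (ι → ℝ) => w.1 - k - ∑ l, b l * w.2 l) (fun w => V w.2)
      (P.map φ)[|{w | V w.2 ∈ B}] ∧
    MemLp (fun w : ℝ × (ι → ℝ) => w.1 - k - ∑ l, b l * w.2 l) 2 (P.map φ)[|{w | V w.2 ∈ B}] ∧
    Var[fun w : ℝ × (ι → ℝ) => w.1 - k - ∑ l, b l * w.2 l; (P.map φ)[|{w | V w.2 ∈ B}]] =
      Var[R; P] ∧
    IsProbabilityMeasure (P.map φ)[|{w | V w.2 ∈ B}] ∧
    ((P.map φ)[|{w | V w.2 ∈ B}]).map Prod.snd = (P.map fun ω l => L l ω)[|V ⁻¹' B] := by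
  have hL' : AEMeasurable (fun ω l => L l ω) P := aemeasurable_pi_lambda _ hL
  have hφm : AEMeasurable φ P := by
    rw [hφ]
    refine AEMeasurable.prodMk ?_ hL'
    exact (hR.aemeasurable.add_const k).add
      (Finset.aemeasurable_fun_sum _ fun l _ => (hL l).const_mul _)
  set F : ℝ × (ι → ℝ) → ℝ := fun w => w.1 - k - ∑ l, b l * w.2 l with hFdef
  have hF : Measurable F := by fun_prop
  have hVs : Measurable fun w : ℝ × (ι → ℝ) => V w.2 := hV.comp measurable_snd
  -- Subtracting the linear part recovers the error, so `F` under the image measure has the law of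
  -- `R`.
  have hFφ : F ∘ φ = R := by
    ext ω
    simp only [hFdef, hφ, Function.comp_apply]
    ring
  have hsnd : Prod.snd ∘ φ = fun ω l => L l ω := by rw [hφ]; rfl
  have : IsProbabilityMeasure (P.map φ) := Measure.isProbabilityMeasure_map hφm
  have hind' : IndepFun F (fun w => V w.2) (P.map φ) := by
    refine indepFun_map hφm hF hVs ?_
    rw [hFφ]
    convert hind using 1
    rw [hφ]
    rfl
  have hmap : (P.map φ).map Prod.snd = P.map fun ω l => L l ω := by
    rw [AEMeasurable.map_map_of_aemeasurable measurable_snd.aemeasurable hφm, hsnd]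
  have hne' : (P.map φ) {w | V w.2 ∈ B} ≠ 0 := by
    rwa [← hmap, Measure.map_apply measurable_snd (hV hB)] at hne
  have hFmap : ((P.map φ)[|{w | V w.2 ∈ B}]).map F = P.map R := by
    rw [show {w : ℝ × (ι → ℝ) | V w.2 ∈ B} = (fun w => V w.2) ⁻¹' B from rfl,
      map_cond_of_indepFun hind' hF hVs hB hne',
      AEMeasurable.map_map_of_aemeasurable hF.aemeasurable hφm, hFφ]
  have hFL : MemLp F 2 (P.map φ) := by
    rw [memLp_map_measure_iff hF.aestronglyMeasurable hφm, hFφ]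
    exact hR
  refine ⟨indepFun_cond_of_indepFun hind' hF hVs hB hne', memLp_cond hFL hne', ?_,
    cond_isProbabilityMeasure hne', ?_⟩
  · have h1 := variance_map (X := id) (μ := (P.map φ)[|{w | V w.2 ∈ B}]) (Y := F)
      aemeasurable_id hF.aemeasurable
    have h2 := variance_map (X := id) (μ := P) (Y := R) aemeasurable_id hR.aemeasurable
    rw [hFmap, h2] at h1
    exact h1.symm
  · rw [← hmap, cond_map measurable_snd.aemeasurable (hV hB)]
    rfl

end LinearResponse

/-! ### Prediction of the latent responses from the exact data. -/

namespace Experiment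

variable {p nf no nc : ℕ} {S : Experiment p nf no nc} {Ω : Type*} [MeasurableSpace Ω]
  {f δ : Input p → Ω → ℝ} {ε : Phys no nc → Ω → ℝ} {P : Measure Ω} [IsProbabilityMeasure P]
  {xnext : Input p}

set_option linter.unusedSectionVars false

/-- Position among all runs of the exactly observed runs. -/
def dataIdx : Fin nf ⊕ Fin no → Fin nf ⊕ Phys no nc := Sum.map id Sum.inl

/-- Position among all runs of the runs with latent response. -/
def latIdx (l : Latent nc) : Fin nf ⊕ Phys no nc := Sum.inr (Sum.inr l)

lemma dataIdx_injective : Function.Injective (dataIdx : Fin nf ⊕ Fin no → Fin nf ⊕ Phys no nc) :=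
  Sum.map_injective.2 ⟨Function.injective_id, Sum.inl_injective⟩

lemma sum_eq_sum_dataIdx_add_sum_latIdx (F : Fin nf ⊕ Phys no nc → ℝ) :
    ∑ i, F i = ∑ j : Fin nf ⊕ Fin no, F (dataIdx j) + ∑ l : Latent nc, F (latIdx l) := by
  simp only [Fintype.sum_sum_type, dataIdx, latIdx, Sum.map_inl, Sum.map_inr, id_eq]
  ring

/-- The exactly observed values as one vector. -/
def dataVec (a : Data nf no) : Fin nf ⊕ Fin no → ℝ := Sum.elim a.1 a.2

lemma dataVec_exactData (j : Fin nf ⊕ Fin no) (ω : Ω) :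
    dataVec (S.exactData f δ ε xnext ω) j = S.runs f δ ε xnext (dataIdx j) ω := by
  rcases j with j | j <;> rfl

lemma continuous_dataVec (j : Fin nf ⊕ Fin no) : Continuous fun a : Data nf no => dataVec a j := by
  rcases j with j | j
  · exact (continuous_apply j).comp continuous_fst
  · exact (continuous_apply j).comp continuous_snd

variable (S) in
/-- Coefficients of the linear prediction of the latent responses by the exactly observed ones. -/
noncomputable def predCoef (xnext : Input p) (l : Latent nc) : Fin nf ⊕ Fin no → ℝ :=
  ((S.gram (S.xPhys xnext)).submatrix dataIdx dataIdx)⁻¹ *ᵥ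
    fun j => S.gram (S.xPhys xnext) (dataIdx j) (latIdx l)

variable (S f δ ε) in
/-- Errors of the linear prediction of the latent responses by the exactly observed ones. -/
noncomputable def innov (xnext : Input p) (l : Latent nc) (ω : Ω) : ℝ :=
  S.runs f δ ε xnext (latIdx l) ω -
    ∑ j, S.predCoef xnext l j * S.runs f δ ε xnext (dataIdx j) ω

variable (S f δ ε) in
/-- A random vector whose law is the conditional law of the latent responses given the exactly
observed ones. -/
noncomputable def latentGiven (xnext : Input p) (a : Data nf no) (l : Latent nc) (ω : Ω) : ℝ :=
  S.innov f δ ε xnext l ω + ∑ j, S.predCoef xnext l j * dataVec a j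

lemma latentGiven_exactData (l : Latent nc) (ω : Ω) :
    S.latentGiven f δ ε xnext (S.exactData f δ ε xnext ω) l ω = S.latent f δ ε xnext ω l := by
  simp only [latentGiven, innov, dataVec_exactData, sub_add_cancel]
  rfl

/-- As a covariance matrix of the runs it is positive semidefinite, and invertibility makes it
definite. -/
lemma IsModel.posDef_gram (h : S.IsModel f δ ε P)
    (hΓ : IsUnit (S.gram (S.xPhys xnext)).det) : (S.gram (S.xPhys xnext)).PosDef := by
  have hcov := h.cov_runs_runs xnext
  have hps : (S.gram (S.xPhys xnext)).PosSemidef := by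
    refine Matrix.PosSemidef.of_dotProduct_mulVec_nonneg ?_ fun c => ?_
    · ext i j
      rw [Matrix.conjTranspose_apply, star_trivial, ← hcov, ← hcov, covariance_comm]
    · have := variance_sum_mul c (h.memLp_runs xnext)
      simp_rw [hcov] at this
      have h0 := variance_nonneg (fun w => ∑ i, c i * S.runs f δ ε xnext i w) P
      rw [this] at h0
      refine h0.trans_eq ?_
      simp only [star_trivial, dotProduct, Matrix.mulVec, Finset.mul_sum]
      refine Finset.sum_congr rfl fun i _ => Finset.sum_congr rfl fun j _ => ?_
      ring
  exact hps.posDef_iff_det_ne_zero.2 hΓ.ne_zero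

/-- As a principal submatrix, the training matrix inherits positive definiteness. -/
lemma gram_train : S.gram S.xTrain = (S.gram (S.xPhys xnext)).submatrix
    (Sum.map id (Sum.map id Sum.inl)) (Sum.map id (Sum.map id Sum.inl)) := by
  ext i j
  rcases i with i | i | i <;> rcases j with j | j | j <;>
    simp [gram, xTrain, xPhys, Matrix.one_apply]

lemma crossCov_train (x : Input p) (i : Fin nf ⊕ (Fin no ⊕ Fin nc)) :
    S.crossCov S.xTrain x i =
      S.crossCov (S.xPhys xnext) x (Sum.map id (Sum.map id Sum.inl) i) := by
  rcases i with i | i | i <;> simp [crossCov, xTrain, xPhys]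

lemma IsModel.isOpenPosMeasure_runs (h : S.IsModel f δ ε P)
    (hΓ : IsUnit (S.gram (S.xPhys xnext)).det) :
    (P.map fun ω i => S.runs f δ ε xnext i ω).IsOpenPosMeasure := by
  refine isOpenPosMeasure_of_hasGaussianLaw ?_ (h.posDef_gram hΓ) (h.cov_runs_runs xnext)
  let L : (Option (Fin nf ⊕ Phys no nc) → ℝ) →L[ℝ] (Fin nf ⊕ Phys no nc → ℝ) :=
    ContinuousLinearMap.pi fun i => ContinuousLinearMap.proj (some i)
  exact (h.hasGaussianLaw_jointVec xnext xnext).map_fun L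

lemma IsModel.aemeasurable_runs (h : S.IsModel f δ ε P) :
    AEMeasurable (fun ω i => S.runs f δ ε xnext i ω) P :=
  aemeasurable_pi_lambda _ fun i => (h.memLp_runs xnext i).aemeasurable

lemma IsModel.isOpenPosMeasure_exactData (h : S.IsModel f δ ε P)
    (hΓ : IsUnit (S.gram (S.xPhys xnext)).det) :
    (P.map (S.exactData f δ ε xnext)).IsOpenPosMeasure := by
  have := h.isOpenPosMeasure_runs hΓ
  let φ : (Fin nf ⊕ Phys no nc → ℝ) → Data nf no :=
    fun t => (fun i => t (Sum.inl i), fun i => t (Sum.inr (Sum.inl i)))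
  have hφ : Continuous φ := by fun_prop
  have e : P.map (S.exactData f δ ε xnext) = (P.map fun ω i => S.runs f δ ε xnext i ω).map φ := by
    rw [AEMeasurable.map_map_of_aemeasurable hφ.measurable.aemeasurable h.aemeasurable_runs]
    rfl
  rw [e]
  exact isOpenPosMeasure_map hφ fun a => ⟨Sum.elim a.1 (Sum.elim a.2 fun _ => 0), rfl⟩

/-- The vector is an affine image of the runs, which have full support. The map is onto: with zero
exact data, the latent coordinates can be chosen to reach any target. -/
lemma IsModel.isOpenPosMeasure_latentGiven (h : S.IsModel f δ ε P)
    (hΓ : IsUnit (S.gram (S.xPhys xnext)).det) (a : Data nf no) :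
    (P.map fun ω l => S.latentGiven f δ ε xnext a l ω).IsOpenPosMeasure := by
  have := h.isOpenPosMeasure_runs hΓ
  let φ : (Fin nf ⊕ Phys no nc → ℝ) → (Latent nc → ℝ) :=
    fun t l => t (latIdx l) - ∑ j, S.predCoef xnext l j * t (dataIdx j) +
      ∑ j, S.predCoef xnext l j * dataVec a j
  have hφ : Continuous φ := by fun_prop
  have e : (P.map fun ω l => S.latentGiven f δ ε xnext a l ω) =
      (P.map fun ω i => S.runs f δ ε xnext i ω).map φ := by
    rw [AEMeasurable.map_map_of_aemeasurable hφ.measurable.aemeasurable h.aemeasurable_runs]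
    rfl
  rw [e]
  refine isOpenPosMeasure_map hφ fun v => ⟨Sum.elim (fun _ => 0) (Sum.elim (fun _ => 0)
    fun l => v l - ∑ j, S.predCoef xnext l j * dataVec a j), ?_⟩
  ext l
  simp [φ, latIdx, dataIdx]

lemma runs_mem_span (x : Input p) (i : Fin nf ⊕ Phys no nc) :
    S.runs f δ ε xnext i ∈ Submodule.span ℝ (Set.range (S.jointVec f δ ε xnext x)) :=
  Submodule.subset_span ⟨some i, rfl⟩

lemma xi_mem_span (x : Input p) :
    xi f δ x ∈ Submodule.span ℝ (Set.range (S.jointVec f δ ε xnext x)) :=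
  Submodule.subset_span ⟨none, rfl⟩

lemma fun_sum_mem_span {ι : Type*} [Fintype ι] {M : Submodule ℝ (Ω → ℝ)} (c : ι → ℝ)
    {X : ι → Ω → ℝ} (hX : ∀ i, X i ∈ M) : (fun ω => ∑ i, c i * X i ω) ∈ M := by
  have : (fun ω => ∑ i, c i * X i ω) = ∑ i, c i • X i := by ext; simp
  rw [this]
  exact M.sum_mem fun i _ => M.smul_mem _ (hX i)

lemma innov_mem_span (x : Input p) (l : Latent nc) :
    S.innov f δ ε xnext l ∈ Submodule.span ℝ (Set.range (S.jointVec f δ ε xnext x)) :=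
  Submodule.sub_mem _ (runs_mem_span x _) (fun_sum_mem_span _ fun _ => runs_mem_span x _)

lemma IsModel.cov_innov (h : S.IsModel f δ ε P) (hΓ : IsUnit (S.gram (S.xPhys xnext)).det)
    (l : Latent nc) (j : Fin nf ⊕ Fin no) :
    cov[S.innov f δ ε xnext l, S.runs f δ ε xnext (dataIdx j); P] = 0 :=
  covariance_sub_sum_inv_mulVec (Z := fun j => S.runs f δ ε xnext (dataIdx j))
    (fun _ => h.memLp_runs _ _) (h.memLp_runs _ _)
    (fun _ _ => h.cov_runs_runs _ _ _) (fun _ => h.cov_runs_runs _ _ _)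
    ((h.posDef_gram hΓ).submatrix dataIdx_injective).det_pos.ne'.isUnit j

lemma IsModel.memLp_innov (h : S.IsModel f δ ε P) (l : Latent nc) :
    MemLp (S.innov f δ ε xnext l) 2 P :=
  (h.memLp_runs _ _).sub (memLp_finsetSum _ fun _ _ => (h.memLp_runs _ _).const_mul _)

lemma IsModel.memLp_latentGiven (h : S.IsModel f δ ε P) (a : Data nf no) (l : Latent nc) :
    MemLp (S.latentGiven f δ ε xnext a l) 2 P :=
  (h.memLp_innov l).add (memLp_const _)

lemma IsModel.memLp_jointVec (h : S.IsModel f δ ε P) (x : Input p)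
    (i : Option (Fin nf ⊕ Phys no nc)) : MemLp (S.jointVec f δ ε xnext x i) 2 P := by
  cases i
  · exact h.memLp_xi x
  · exact h.memLp_runs _ _

lemma IsModel.aemeasurable_exactData (h : S.IsModel f δ ε P) :
    AEMeasurable (S.exactData f δ ε xnext) P :=
  (aemeasurable_pi_lambda _ fun _ => (h.memLp_f _).aemeasurable).prodMk
    (aemeasurable_pi_lambda _ fun _ => (h.memLp_response _ _).aemeasurable)

/-! ### Explicit conditional laws given the exact data. -/

section ConditionalLaw

variable {x : Input p} {R : Ω → ℝ} {β : Fin nf ⊕ Phys no nc → ℝ}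

/-- The residual and the innovations are packed into one family indexed by `Option`, since joint
independence from the data is required. -/
lemma IsModel.indepFun_exactData (h : S.IsModel f δ ε P)
    (hΓ : IsUnit (S.gram (S.xPhys xnext)).det)
    (hR : R ∈ Submodule.span ℝ (Set.range (S.jointVec f δ ε xnext x)))
    (hcov : ∀ j, cov[R, S.runs f δ ε xnext (dataIdx j); P] = 0) :
    IndepFun (S.exactData f δ ε xnext)
      (fun ω => (R ω, fun l => S.innov f δ ε xnext l ω)) P := by
  let X : Option (Latent nc) → Ω → ℝ := fun k => k.elim R (S.innov f δ ε xnext)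
  have h1 : IndepFun (fun ω k => X k ω) (fun ω j => S.runs f δ ε xnext (dataIdx j) ω) P := by
    refine indepFun_of_mem_span (h.hasGaussianLaw_jointVec xnext x) (fun k => ?_)
      (fun j => runs_mem_span x _) fun k j => ?_
    · cases k
      · exact hR
      · exact innov_mem_span x _
    · cases k
      · exact hcov j
      · exact h.cov_innov hΓ _ j
  let φ : (Option (Latent nc) → ℝ) → ℝ × (Latent nc → ℝ) := fun v => (v none, fun l => v (some l))
  let ψ : (Fin nf ⊕ Fin no → ℝ) → Data nf no :=
    fun v => (fun i => v (Sum.inl i), fun i => v (Sum.inr i))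
  exact (h1.comp (show Measurable φ by fun_prop) (show Measurable ψ by fun_prop)).symm

/-- `R` and `β` are left general because two regressions are used: on all runs for the criterion,
and on the training runs for the predictive variance. -/
lemma IsModel.exists_isContCondLaw_xi_latent (h : S.IsModel f δ ε P)
    (hΓ : IsUnit (S.gram (S.xPhys xnext)).det)
    (hR : R ∈ Submodule.span ℝ (Set.range (S.jointVec f δ ε xnext x)))
    (hcov : ∀ j, cov[R, S.runs f δ ε xnext (dataIdx j); P] = 0)
    (hxi : ∀ ω, xi f δ x ω = R ω + ∑ i, β i * S.runs f δ ε xnext i ω) :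
    ∃ κ : Data nf no → ProbabilityMeasure (ℝ × (Latent nc → ℝ)),
      IsContCondLaw (fun ω => (xi f δ x ω, S.latent f δ ε xnext ω))
        (S.exactData f δ ε xnext) P κ ∧
      ∀ a, (κ a : Measure (ℝ × (Latent nc → ℝ))) =
        P.map fun ω => (R ω + ∑ j, β (dataIdx j) * dataVec a j +
          ∑ l, β (latIdx l) * S.latentGiven f δ ε xnext a l ω,
          fun l => S.latentGiven f δ ε xnext a l ω) := by
  have hRm : AEMeasurable R P := (memLp_of_mem_span (h.memLp_jointVec x) hR).aemeasurable
  have hV : AEMeasurable (fun ω => (R ω, fun l => S.innov f δ ε xnext l ω)) P :=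
    hRm.prodMk (aemeasurable_pi_lambda _ fun l => (h.memLp_innov l).aemeasurable)
  let g : ℝ × (Latent nc → ℝ) → Data nf no → ℝ × (Latent nc → ℝ) := fun v a =>
    (v.1 + ∑ j, β (dataIdx j) * dataVec a j +
      ∑ l, β (latIdx l) * (v.2 l + ∑ j, S.predCoef xnext l j * dataVec a j),
      fun l => v.2 l + ∑ j, S.predCoef xnext l j * dataVec a j)
  have hg : Continuous (Function.uncurry g) := by
    have := continuous_dataVec (nf := nf) (no := no)
    have h2 (j : Fin nf ⊕ Fin no) : Continuous
        fun q : (ℝ × (Latent nc → ℝ)) × Data nf no => dataVec q.2 j :=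
      (this j).comp continuous_snd
    change Continuous fun q : (ℝ × (Latent nc → ℝ)) × Data nf no => g q.1 q.2
    fun_prop
  refine exists_isContCondLaw_of_indepFun (g := g) h.aemeasurable_exactData hV
    (h.indepFun_exactData hΓ hR hcov) hg.measurable
    (fun v => hg.comp (Continuous.prodMk_right v)) ?_
  funext ω
  refine Prod.ext ?_ (funext fun l => (latentGiven_exactData l ω).symm)
  have h3 (l : Latent nc) : S.innov f δ ε xnext l ω + ∑ j, S.predCoef xnext l j *
      dataVec (S.exactData f δ ε xnext ω) j = S.runs f δ ε xnext (latIdx l) ω :=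
    latentGiven_exactData l ω
  simp only [dataVec_exactData] at h3
  simp only [g, dataVec_exactData, h3]
  rw [hxi, sum_eq_sum_dataIdx_add_sum_latIdx, add_assoc]

lemma IsModel.exists_isContCondLaw_latent (h : S.IsModel f δ ε P)
    (hΓ : IsUnit (S.gram (S.xPhys xnext)).det) :
    ∃ κ : Data nf no → ProbabilityMeasure (Latent nc → ℝ),
      IsContCondLaw (S.latent f δ ε xnext) (S.exactData f δ ε xnext) P κ ∧
      ∀ a, (κ a : Measure (Latent nc → ℝ)) =
        P.map fun ω l => S.latentGiven f δ ε xnext a l ω := by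
  have hV : AEMeasurable (fun ω l => S.innov f δ ε xnext l ω) P :=
    aemeasurable_pi_lambda _ fun l => (h.memLp_innov l).aemeasurable
  let g : (Latent nc → ℝ) → Data nf no → (Latent nc → ℝ) := fun v a l =>
    v l + ∑ j, S.predCoef xnext l j * dataVec a j
  have hg : Continuous (Function.uncurry g) := by
    have h2 (j : Fin nf ⊕ Fin no) : Continuous
        fun q : (Latent nc → ℝ) × Data nf no => dataVec q.2 j :=
      (continuous_dataVec j).comp continuous_snd
    change Continuous fun q : (Latent nc → ℝ) × Data nf no => g q.1 q.2
    fun_prop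
  have hind : IndepFun (S.exactData f δ ε xnext) (fun ω l => S.innov f δ ε xnext l ω) P :=
    -- Only the innovations matter here, so the residual is taken to be zero and the input is
    -- arbitrary.
    (h.indepFun_exactData (x := xnext) (R := 0) hΓ (Submodule.zero_mem _)
      (fun j => covariance_zero_left)).comp measurable_id measurable_snd
  refine exists_isContCondLaw_of_indepFun (g := g) h.aemeasurable_exactData hV hind hg.measurable
    (fun v => hg.comp (Continuous.prodMk_right v)) ?_
  funext ω l
  exact (latentGiven_exactData l ω).symm

end ConditionalLaw

end Experiment

namespace Experiment

variable {p nf no nc : ℕ} {S : Experiment p nf no nc} {Ω : Type*} [MeasurableSpace Ω]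
  {f δ : Input p → Ω → ℝ} {ε : Phys no nc → Ω → ℝ} {P : Measure Ω} [IsProbabilityMeasure P]
  {xnext : Input p} {a : Data nf no}

/-! ### Quadratic forms of padded matrices. -/

section QuadraticForms

lemma dotProduct_pad_mulVec {L : Type*} [Fintype L] (M : Matrix L L ℝ)
    (β : Fin nf ⊕ (Fin no ⊕ L) → ℝ) :
    β ⬝ᵥ (pad M *ᵥ β) =
      ∑ k, ∑ l, β (Sum.inr (Sum.inr k)) * β (Sum.inr (Sum.inr l)) * M k l := by
  simp only [pad, dotProduct, Matrix.mulVec, Fintype.sum_sum_type, Matrix.fromBlocks_apply₁₁,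
    Matrix.fromBlocks_apply₁₂, Matrix.fromBlocks_apply₂₁, Matrix.fromBlocks_apply₂₂,
    Matrix.zero_apply, zero_mul, Finset.sum_const_zero, mul_zero, zero_add, Finset.mul_sum]
  refine Finset.sum_congr rfl fun i _ => Finset.sum_congr rfl fun j _ => ?_
  ring

lemma dotProduct_inv_mul_mul_inv {ι : Type*} [Fintype ι] [DecidableEq ι] {Γ : Matrix ι ι ℝ}
    (hΓ : Γ.PosDef) (H : Matrix ι ι ℝ) (γ : ι → ℝ) :
    γ ⬝ᵥ ((Γ⁻¹ * H * Γ⁻¹) *ᵥ γ) = (Γ⁻¹ *ᵥ γ) ⬝ᵥ (H *ᵥ (Γ⁻¹ *ᵥ γ)) := by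
  have hs : Γ⁻¹ᵀ = Γ⁻¹ := by
    have := hΓ.isHermitian.inv
    rwa [Matrix.IsHermitian, Matrix.conjTranspose_eq_transpose_of_trivial] at this
  rw [← Matrix.mulVec_mulVec, ← Matrix.mulVec_mulVec, Matrix.dotProduct_mulVec γ Γ⁻¹,
    ← Matrix.mulVec_transpose, hs]

end QuadraticForms

/-! ### The posterior law of the latent vector and the form of `H_c`. -/

section LatentPosterior

lemma IsModel.latentLaw_eq (h : S.IsModel f δ ε P)
    (hΓ : IsUnit (S.gram (S.xPhys xnext)).det) :
    S.latentLaw f δ ε P xnext a = P.map fun ω l => S.latentGiven f δ ε xnext a l ω := by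
  have := h.isOpenPosMeasure_exactData hΓ
  obtain ⟨κ, hκ, hκa⟩ := h.exists_isContCondLaw_latent hΓ
  rw [latentLaw, hκ.condLaw_eq, hκa]

lemma measurableSet_trainCensored : MeasurableSet S.trainCensored := by
  rw [trainCensored, Set.ofPred_forall]
  exact MeasurableSet.iInter fun j => measurableSet_le measurable_const (measurable_pi_apply _)

lemma nextUncensored_eq : S.nextUncensored = S.nextCensoredᶜ := by
  ext w
  simp [nextUncensored, nextCensored]

lemma IsModel.isProbabilityMeasure_latentLaw (h : S.IsModel f δ ε P)
    (hΓ : IsUnit (S.gram (S.xPhys xnext)).det) :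
    IsProbabilityMeasure (S.latentLaw f δ ε P xnext a) := by
  rw [h.latentLaw_eq hΓ]
  exact Measure.isProbabilityMeasure_map
    (aemeasurable_pi_lambda _ fun l => (h.memLp_latentGiven a l).aemeasurable)

/-- Each event contains a nonempty open set, given by strict inequalities, which a law of full
support charges. So every conditioning that follows is on an event of positive probability. -/
lemma IsModel.latentLaw_trainCensored_inter_ne_zero (h : S.IsModel f δ ε P)
    (hΓ : IsUnit (S.gram (S.xPhys xnext)).det) :
    S.latentLaw f δ ε P xnext a (S.trainCensored ∩ S.nextCensored) ≠ 0 ∧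
      S.latentLaw f δ ε P xnext a (S.trainCensored ∩ S.nextCensoredᶜ) ≠ 0 := by
  have := h.isOpenPosMeasure_latentGiven hΓ a
  rw [← h.latentLaw_eq hΓ] at this
  have ho : IsOpen {w : Latent nc → ℝ | ∀ j : Fin nc, S.limit < w (Sum.inl j)} := by
    rw [Set.ofPred_forall]
    exact isOpen_iInter_of_finite fun j => isOpen_lt continuous_const (continuous_apply _)
  have hN : IsOpen {w : Latent nc → ℝ | S.limit < w (Sum.inr ())} :=
    isOpen_lt continuous_const (continuous_apply _)
  have hU : IsOpen {w : Latent nc → ℝ | w (Sum.inr ()) < S.limit} :=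
    isOpen_lt (continuous_apply _) continuous_const
  constructor
  · exact fun h0 => (ho.inter hN).measure_ne_zero (S.latentLaw f δ ε P xnext a)
      ⟨fun _ => S.limit + 1, fun _ => lt_add_one _, lt_add_one S.limit⟩
      (measure_mono_null (t := S.trainCensored ∩ S.nextCensored)
        (fun w hw => ⟨fun j => (hw.1 j).le, (show S.limit < w (Sum.inr ()) from hw.2).le⟩) h0)
  · exact fun h0 => (ho.inter hU).measure_ne_zero (S.latentLaw f δ ε P xnext a)
      ⟨Sum.elim (fun _ => S.limit + 1) (fun _ => S.limit - 1), fun _ => lt_add_one S.limit,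
        sub_one_lt S.limit⟩
      (measure_mono_null (t := S.trainCensored ∩ S.nextCensoredᶜ)
        (fun w hw => ⟨fun j => (hw.1 j).le,
          fun h1 => not_le.2 (show w (Sum.inr ()) < S.limit from hw.2) h1⟩) h0)

lemma IsModel.latentLaw_trainCensored_ne_zero (h : S.IsModel f δ ε P)
    (hΓ : IsUnit (S.gram (S.xPhys xnext)).det) :
    S.latentLaw f δ ε P xnext a S.trainCensored ≠ 0 := fun h0 =>
  (h.latentLaw_trainCensored_inter_ne_zero hΓ).1 (measure_mono_null Set.inter_subset_left h0)

lemma IsModel.isProbabilityMeasure_latentPost (h : S.IsModel f δ ε P)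
    (hΓ : IsUnit (S.gram (S.xPhys xnext)).det) :
    IsProbabilityMeasure (S.latentPost f δ ε P xnext a) := by
  have := h.isProbabilityMeasure_latentLaw (a := a) hΓ
  exact cond_isProbabilityMeasure (h.latentLaw_trainCensored_ne_zero hΓ)

lemma IsModel.latentPost_nextCensored_ne_zero (h : S.IsModel f δ ε P)
    (hΓ : IsUnit (S.gram (S.xPhys xnext)).det) :
    S.latentPost f δ ε P xnext a S.nextCensored ≠ 0 ∧
      S.latentPost f δ ε P xnext a S.nextCensoredᶜ ≠ 0 := by
  have := h.isProbabilityMeasure_latentLaw (a := a) hΓ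
  have h1 := h.latentLaw_trainCensored_inter_ne_zero (a := a) hΓ
  rw [latentPost, cond_apply measurableSet_trainCensored, cond_apply measurableSet_trainCensored]
  exact ⟨mul_ne_zero (ENNReal.inv_ne_zero.2 (measure_ne_top _ _)) h1.1,
    mul_ne_zero (ENNReal.inv_ne_zero.2 (measure_ne_top _ _)) h1.2⟩

lemma censorProb_eq :
    S.censorProb f δ ε P xnext a = (S.latentPost f δ ε P xnext a).real S.nextCensored := by
  rw [censorProb, latentPost, measureReal_def (μ := (_)[|_]),
    cond_apply measurableSet_trainCensored, ENNReal.toReal_mul, ENNReal.toReal_inv, div_eq_inv_mul]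
  rfl

lemma IsModel.memLp_latentPost (h : S.IsModel f δ ε P)
    (hΓ : IsUnit (S.gram (S.xPhys xnext)).det) (l : Latent nc) :
    MemLp (fun w => w l) 2 (S.latentPost f δ ε P xnext a) := by
  refine memLp_cond ?_ (h.latentLaw_trainCensored_ne_zero hΓ)
  rw [h.latentLaw_eq hΓ, memLp_map_measure_iff (measurable_pi_apply l).aestronglyMeasurable
    (aemeasurable_pi_lambda _ fun l => (h.memLp_latentGiven a l).aemeasurable)]
  exact h.memLp_latentGiven a l

/-- The quadratic form of `H_c`, with the expected conditional covariances of all latent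
responses. -/
lemma IsModel.dotProduct_hMatrix_mulVec (h : S.IsModel f δ ε P)
    (hΓ : IsUnit (S.gram (S.xPhys xnext)).det) (β : Fin nf ⊕ Phys no nc → ℝ) :
    β ⬝ᵥ (S.hMatrix f δ ε P xnext a *ᵥ β) =
      (1 - S.censorProb f δ ε P xnext a) *
        ∑ i, ∑ j, β (latIdx i) * β (latIdx j) *
          (cov[fun v => v i, fun v => v j; S.postUncensored f δ ε P xnext a] -
            ∫ v, (v i - condMeanNext (S.postUncensored f δ ε P xnext a) i v) *
              (v j - condMeanNext (S.postUncensored f δ ε P xnext a) j v)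
              ∂(S.postUncensored f δ ε P xnext a)) +
      S.censorProb f δ ε P xnext a * (1 - S.censorProb f δ ε P xnext a) *
        (∑ l, β (latIdx l) * S.meanShift f δ ε P xnext a l) ^ 2 := by
  have hne := (h.latentPost_nextCensored_ne_zero (a := a) hΓ).2
  have := h.isProbabilityMeasure_latentPost (a := a) hΓ
  have hprob : IsProbabilityMeasure (S.postUncensored f δ ε P xnext a) := by
    rw [postUncensored, nextUncensored_eq]
    exact cond_isProbabilityMeasure hne
  have hm : Integrable (fun w : Latent nc → ℝ => w (Sum.inr ()))
      (S.postUncensored f δ ε P xnext a) := by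
    rw [postUncensored, nextUncensored_eq]
    exact (memLp_cond (h.memLp_latentPost hΓ _) hne).integrable one_le_two
  -- `Y'_{n+1}` is its own conditional mean, so its residual vanishes; this explains the zero last
  -- row and column of `Σ̂`.
  have hnext (u : Unit) : condMeanNext (S.postUncensored f δ ε P xnext a) (Sum.inr u) =
      fun w : Latent nc → ℝ => w (Sum.inr u) :=
    condExp_of_stronglyMeasurable (measurable_pi_apply _).comap_le
      (comap_measurable _).stronglyMeasurable hm
  have hC (i j : Latent nc) : ∫ v, (v i - condMeanNext (S.postUncensored f δ ε P xnext a) i v) *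
      (v j - condMeanNext (S.postUncensored f δ ε P xnext a) j v)
      ∂(S.postUncensored f δ ε P xnext a) =
      (Matrix.fromBlocks (S.meanCondCov f δ ε P xnext a) 0 0 0 :
        Matrix (Latent nc) (Latent nc) ℝ) i j := by
    rcases i with i | i <;> rcases j with j | j <;> simp [hnext, meanCondCov]
  simp only [hC]
  rw [hMatrix]
  simp only [Matrix.add_mulVec, Matrix.smul_mulVec, Matrix.sub_mulVec, dotProduct_add,
    dotProduct_sub, dotProduct_smul, dotProduct_pad_mulVec, smul_eq_mul]
  congr 2
  · rw [← Finset.sum_sub_distrib]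
    refine Finset.sum_congr rfl fun i _ => ?_
    rw [← Finset.sum_sub_distrib]
    refine Finset.sum_congr rfl fun j _ => ?_
    rw [mul_sub]
    rfl
  · rw [sq, Finset.sum_mul_sum]
    refine Finset.sum_congr rfl fun i _ => Finset.sum_congr rfl fun j _ => ?_
    rw [Matrix.vecMulVec_apply, latIdx, latIdx]
    ring

end LatentPosterior

/-! ### The criterion and the predictive variance. -/

section Criterion

/-- Under the posterior law, `ξ(x)` is a linear function of the latent responses up to an error
whose variance is not affected by the censored data. -/
lemma IsModel.posterior_residual (h : S.IsModel f δ ε P)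
    (hΓ : IsUnit (S.gram (S.xPhys xnext)).det) {x : Input p} {R : Ω → ℝ}
    {β : Fin nf ⊕ Phys no nc → ℝ} {γ : Type*} [MeasurableSpace γ] {V : (Latent nc → ℝ) → γ}
    {B : Set γ} (hRs : R ∈ Submodule.span ℝ (Set.range (S.jointVec f δ ε xnext x)))
    (hcov : ∀ j, cov[R, S.runs f δ ε xnext (dataIdx j); P] = 0)
    (hxi : ∀ ω, xi f δ x ω = R ω + ∑ i, β i * S.runs f δ ε xnext i ω)
    (hV : Measurable V) (hB : MeasurableSet B) (hVB : V ⁻¹' B = S.trainCensored)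
    (hind : IndepFun R (fun ω => V fun l => S.latentGiven f δ ε xnext a l ω) P) :
    ∃ k : ℝ, IndepFun (fun w : ℝ × (Latent nc → ℝ) => w.1 - k - ∑ l, β (latIdx l) * w.2 l)
        (fun w => V w.2) (S.posterior f δ ε P xnext a x) ∧
      MemLp (fun w : ℝ × (Latent nc → ℝ) => w.1 - k - ∑ l, β (latIdx l) * w.2 l) 2
        (S.posterior f δ ε P xnext a x) ∧
      Var[fun w : ℝ × (Latent nc → ℝ) => w.1 - k - ∑ l, β (latIdx l) * w.2 l;
        S.posterior f δ ε P xnext a x] = Var[R; P] ∧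
      IsProbabilityMeasure (S.posterior f δ ε P xnext a x) ∧
      (S.posterior f δ ε P xnext a x).map Prod.snd = S.latentPost f δ ε P xnext a := by
  have := h.isOpenPosMeasure_exactData hΓ
  obtain ⟨κ, hκ, hκa⟩ := h.exists_isContCondLaw_xi_latent hΓ hRs hcov hxi
  have hset : {w : ℝ × (Latent nc → ℝ) | ∀ j : Fin nc, S.limit ≤ w.2 (Sum.inl j)} =
      {w | V w.2 ∈ B} := by
    change Prod.snd ⁻¹' S.trainCensored = _
    rw [← hVB]
    rfl
  -- The residual need only be independent of `V`: the whole latent vector in `cmse_eq`, the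
  -- censored coordinates alone in `predVar_eq`.
  have hres := residual_cond (k := ∑ j, β (dataIdx j) * dataVec a j)
    (b := fun l => β (latIdx l)) rfl (memLp_of_mem_span (h.memLp_jointVec x) hRs)
    (fun l => (h.memLp_latentGiven (xnext := xnext) a l).aemeasurable) hV hind hB (by
      rw [← h.latentLaw_eq hΓ, hVB]
      exact h.latentLaw_trainCensored_ne_zero hΓ)
  refine ⟨∑ j, β (dataIdx j) * dataVec a j, ?_⟩
  rw [posterior, hκ.condLaw_eq, hκa, hset, latentPost, h.latentLaw_eq hΓ, ← hVB]
  exact hres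

/-- Regression on all runs makes the residual independent of the whole latent vector, so
`integral_condVar_comap_censor` applies under the posterior. -/
lemma IsModel.cmse_eq (h : S.IsModel f δ ε P)
    (hΓ : IsUnit (S.gram (S.xPhys xnext)).det) (x : Input p) :
    S.cmse f δ ε P xnext a x = S.explicitIntegrand f δ ε P xnext a x := by
  have hpos := h.posDef_gram hΓ
  set Γ := S.gram (S.xPhys xnext) with hΓdef
  set β := Γ⁻¹ *ᵥ S.crossCov (S.xPhys xnext) x with hβ
  set R : Ω → ℝ := fun ω => xi f δ x ω - ∑ i, β i * S.runs f δ ε xnext i ω with hR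
  have hcov (i : Fin nf ⊕ Phys no nc) : cov[R, S.runs f δ ε xnext i; P] = 0 :=
    covariance_sub_sum_inv_mulVec (h.memLp_runs xnext) (h.memLp_xi x) (h.cov_runs_runs xnext)
      (h.cov_runs_xi xnext x) hΓ i
  have hRs : R ∈ Submodule.span ℝ (Set.range (S.jointVec f δ ε xnext x)) :=
    Submodule.sub_mem _ (xi_mem_span x) (fun_sum_mem_span _ fun _ => runs_mem_span x _)
  have hR2 : MemLp R 2 P := memLp_of_mem_span (h.memLp_jointVec x) hRs
  have hind : IndepFun R (fun ω => id fun l => S.latentGiven f δ ε xnext a l ω) P := by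
    have h1 : IndepFun (fun ω (_ : Unit) => R ω) (fun ω i => S.runs f δ ε xnext i ω) P :=
      indepFun_of_mem_span (h.hasGaussianLaw_jointVec xnext x) (fun _ => hRs)
        (fun i => runs_mem_span x i) fun _ i => hcov i
    let φ : (Fin nf ⊕ Phys no nc → ℝ) → (Latent nc → ℝ) :=
      fun t l => t (latIdx l) - ∑ j, S.predCoef xnext l j * t (dataIdx j) +
        ∑ j, S.predCoef xnext l j * dataVec a j
    exact h1.comp (measurable_pi_apply ()) (show Measurable φ by fun_prop)
  obtain ⟨k, hindQ, hF2, -, hprob, hmap⟩ := h.posterior_residual hΓ hRs (fun j => hcov _)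
    (β := β) (fun ω => (sub_add_cancel _ _).symm) measurable_id
    (measurableSet_trainCensored (S := S)) rfl hind
  have hne := h.latentPost_nextCensored_ne_zero (a := a) hΓ
  have key := integral_condVar_comap_censor (Q := S.posterior f δ ε P xnext a x)
    (X := fun w => w.1) (V := Prod.snd) (fun l => β (latIdx l))
    k (Sum.inr ()) S.limit measurable_snd (by fun_prop)
    (by funext w; ring) hindQ hF2 (fun l => by
      have := h.memLp_latentPost (a := a) hΓ l
      rw [← hmap] at this
      exact this.comp_of_map measurable_snd.aemeasurable)
    hmap hne.2 hne.1 (ν := S.postUncensored f δ ε P xnext a)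
    (ν' := S.postCensored f δ ε P xnext a) (by rw [postUncensored, nextUncensored_eq]; rfl) rfl
  have e : S.explicitIntegrand f δ ε P xnext a x = S.predVar f δ ε P xnext a x -
      S.crossCov (S.xPhys xnext) x ⬝ᵥ ((Γ⁻¹ * S.hMatrix f δ ε P xnext a * Γ⁻¹) *ᵥ
        S.crossCov (S.xPhys xnext) x) := rfl
  rw [cmse, key, e, dotProduct_inv_mul_mul_inv hpos, ← hβ, h.dotProduct_hMatrix_mulVec hΓ,
    censorProb_eq]
  rfl

/-- Regression on the training runs suffices, as the posterior conditions only on the exact data and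
`y_c'`. The residual is independent of the linear combination of the `y_c'`, so the two variances
add. -/
lemma IsModel.predVar_eq (h : S.IsModel f δ ε P)
    (hΓ : IsUnit (S.gram (S.xPhys xnext)).det) (x : Input p) :
    S.predVar f δ ε P xnext a x =
      (S.varF : ℝ) + (S.varD : ℝ) -
        S.crossCov S.xTrain x ⬝ᵥ
          (((S.gram S.xTrain)⁻¹ - (S.gram S.xTrain)⁻¹ *
            pad (S.censoredCov f δ ε P xnext a) * (S.gram S.xTrain)⁻¹) *ᵥ
              S.crossCov S.xTrain x) := by
  let e : Fin nf ⊕ (Fin no ⊕ Fin nc) → Fin nf ⊕ Phys no nc := Sum.map id (Sum.map id Sum.inl)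
  have he : Function.Injective e := Sum.map_injective.2
    ⟨Function.injective_id, Sum.map_injective.2 ⟨Function.injective_id, Sum.inl_injective⟩⟩
  have hpos : (S.gram S.xTrain).PosDef := by
    rw [gram_train (xnext := xnext)]
    exact (h.posDef_gram hΓ).submatrix he
  have hdet : IsUnit (S.gram S.xTrain).det := hpos.det_pos.ne'.isUnit
  set Γ := S.gram S.xTrain with hΓdef
  set γ := S.crossCov S.xTrain x with hγ
  set β := Γ⁻¹ *ᵥ γ with hβ
  let T : Fin nf ⊕ (Fin no ⊕ Fin nc) → Ω → ℝ := fun i => S.runs f δ ε xnext (e i)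
  have hT (i) : MemLp (T i) 2 P := h.memLp_runs xnext (e i)
  have hTT (i j) : cov[T i, T j; P] = Γ i j := by
    rw [hΓdef, gram_train (xnext := xnext)]
    exact h.cov_runs_runs xnext _ _
  have hTx (i) : cov[T i, xi f δ x; P] = γ i := by
    rw [hγ, crossCov_train (xnext := xnext)]
    exact h.cov_runs_xi xnext x _
  set R : Ω → ℝ := fun ω => xi f δ x ω - ∑ i, β i * T i ω with hR
  have hcov (i) : cov[R, T i; P] = 0 :=
    covariance_sub_sum_inv_mulVec hT (h.memLp_xi x) hTT hTx hdet i
  have hvarR : Var[R; P] = Var[xi f δ x; P] - γ ⬝ᵥ β :=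
    variance_sub_sum_inv_mulVec hT (h.memLp_xi x) hTT hTx hdet
  have hRs : R ∈ Submodule.span ℝ (Set.range (S.jointVec f δ ε xnext x)) :=
    Submodule.sub_mem _ (xi_mem_span x) (fun_sum_mem_span _ fun _ => runs_mem_span x _)
  have hR2 : MemLp R 2 P := memLp_of_mem_span (h.memLp_jointVec x) hRs
  -- The training coefficients are extended by zero at the potential run, to match the general form
  -- of `posterior_residual`.
  let β' : Fin nf ⊕ Phys no nc → ℝ := Sum.elim (fun i => β (Sum.inl i))
    (Sum.elim (fun i => β (Sum.inr (Sum.inl i)))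
      (Sum.elim (fun i => β (Sum.inr (Sum.inr i))) fun _ => 0))
  have hdata (j : Fin nf ⊕ Fin no) :
      (dataIdx j : Fin nf ⊕ Phys no nc) = e (Sum.map id Sum.inl j) := by
    rcases j with j | j <;> rfl
  have hxi (ω : Ω) : xi f δ x ω = R ω + ∑ i, β' i * S.runs f δ ε xnext i ω := by
    have : ∑ i, β' i * S.runs f δ ε xnext i ω = ∑ i, β i * T i ω := by
      simp [Fintype.sum_sum_type, β', T, e]
    rw [this]
    exact (sub_add_cancel _ _).symm
  let V : (Latent nc → ℝ) → (Fin nc → ℝ) := fun v j => v (Sum.inl j)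
  have hV : Measurable V := by fun_prop
  have hind : IndepFun R (fun ω => V fun l => S.latentGiven f δ ε xnext a l ω) P := by
    have h1 : IndepFun (fun ω (_ : Unit) => R ω) (fun ω i => T i ω) P :=
      indepFun_of_mem_span (h.hasGaussianLaw_jointVec xnext x) (fun _ => hRs)
        (fun i => runs_mem_span x _) fun _ i => hcov i
    -- The censored coordinates of `latentGiven` involve training runs only, which are the runs the
    -- residual is independent of.
    let φ : (Fin nf ⊕ (Fin no ⊕ Fin nc) → ℝ) → (Fin nc → ℝ) :=
      fun t l => t (Sum.inr (Sum.inr l)) -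
        ∑ j, S.predCoef xnext (Sum.inl l) j * t (Sum.map id Sum.inl j) +
        ∑ j, S.predCoef xnext (Sum.inl l) j * dataVec a j
    have h2 := h1.comp (measurable_pi_apply ()) (show Measurable φ by fun_prop)
    have e2 : (fun ω => V fun l => S.latentGiven f δ ε xnext a l ω) =
        φ ∘ fun ω i => T i ω := by
      funext ω j
      simp only [V, φ, latentGiven, innov, Function.comp_apply, T, hdata]
      rfl
    rw [e2]
    exact h2
  have hB : MeasurableSet {u : Fin nc → ℝ | ∀ j, S.limit ≤ u j} := by
    rw [Set.ofPred_forall]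
    exact MeasurableSet.iInter fun j => measurableSet_le measurable_const (measurable_pi_apply _)
  obtain ⟨k, hindQ, hF2, hvar, hprob, hmap⟩ := h.posterior_residual hΓ hRs
    (fun j => by rw [hdata]; exact hcov _) hxi hV hB rfl hind
  set Q := S.posterior f δ ε P xnext a x with hQ
  set F : ℝ × (Latent nc → ℝ) → ℝ := fun w =>
    w.1 - k - ∑ l, β' (latIdx l) * w.2 l with hF
  have hl (l : Fin nc) : MemLp (fun w : ℝ × (Latent nc → ℝ) => w.2 (Sum.inl l)) 2 Q := by
    have := h.memLp_latentPost (a := a) hΓ (Sum.inl l)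
    rw [← hmap] at this
    exact this.comp_of_map measurable_snd.aemeasurable
  let G : ℝ × (Latent nc → ℝ) → ℝ := fun w =>
    ∑ l : Fin nc, β (Sum.inr (Sum.inr l)) * w.2 (Sum.inl l)
  have hG2 : MemLp G 2 Q := memLp_finsetSum _ fun l _ => (hl l).const_mul _
  have hdecomp : (fun w : ℝ × (Latent nc → ℝ) => w.1) =
      fun w => k + (F w + G w) := by
    funext w
    have : ∑ l, β' (latIdx l) * w.2 l = G w := by
      simp [Fintype.sum_sum_type, β', latIdx, G]
    simp only [hF, this]
    ring
  have hFG : IndepFun F G Q := by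
    have : Measurable fun u : Fin nc → ℝ => ∑ l, β (Sum.inr (Sum.inr l)) * u l := by fun_prop
    exact hindQ.comp measurable_id this
  have hcens (i j : Fin nc) : cov[fun w : ℝ × (Latent nc → ℝ) => w.2 (Sum.inl i),
      fun w => w.2 (Sum.inl j); Q] = S.censoredCov f δ ε P xnext a i j := by
    rw [censoredCov, Matrix.of_apply, ← hmap, covariance_map
      (measurable_pi_apply _).aestronglyMeasurable (measurable_pi_apply _).aestronglyMeasurable
      measurable_snd.aemeasurable]
    rfl
  have hvarG : Var[G; Q] = ∑ i : Fin nc, ∑ j : Fin nc, β (Sum.inr (Sum.inr i)) *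
      β (Sum.inr (Sum.inr j)) * S.censoredCov f δ ε P xnext a i j := by
    simp only [← hcens]
    exact variance_sum_mul (X := fun (l : Fin nc) (w : ℝ × (Latent nc → ℝ)) => w.2 (Sum.inl l))
      (fun l => β (Sum.inr (Sum.inr l))) hl
  have htot : Var[fun w : ℝ × (Latent nc → ℝ) => w.1; Q] = Var[F; Q] + Var[G; Q] := by
    rw [hdecomp, variance_const_add (X := fun w => F w + G w) (hF2.add hG2).aestronglyMeasurable,
      hFG.variance_fun_add hF2 hG2]
  have hquad : γ ⬝ᵥ ((Γ⁻¹ - Γ⁻¹ * pad (S.censoredCov f δ ε P xnext a) * Γ⁻¹) *ᵥ γ) =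
      γ ⬝ᵥ β - Var[G; Q] := by
    rw [Matrix.sub_mulVec, dotProduct_sub, dotProduct_inv_mul_mul_inv hpos, ← hβ,
      dotProduct_pad_mulVec, hvarG]
  rw [hquad, ← h.variance_xi (x := x), ← sub_add, ← hvarR, ← hvar, ← htot]
  rfl

end Criterion

/-! ### Integrability over the input space. -/

section Integrability

lemma IsCorrelation.abs_le_one {X : Type*} {R : X → X → ℝ} (hR : IsCorrelation R) (x y : X) :
    |R x y| ≤ 1 := by
  classical
  by_cases hxy : x = y
  · rw [hxy, hR.diag, abs_one]
  -- Positive semidefiniteness on `{x, y}` with weights `1` and `s`; the values `s = 1` and `s = -1`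
  -- give the two bounds.
  have h (s : ℝ) : 0 ≤ 1 + 2 * s * R x y + s ^ 2 := by
    have := hR.posSemidef {x, y} (fun z => if z = x then 1 else s)
    simp only [Finset.sum_pair hxy, if_true, if_neg (Ne.symm hxy), hR.diag, hR.symm y x] at this
    linarith
  have h1 := h 1
  have h2 := h (-1)
  exact abs_le.2 ⟨by linarith, by linarith⟩

lemma integrable_dotProduct_mulVec {α ι : Type*} [MeasurableSpace α] [Fintype ι] {μ : Measure α}
    [IsFiniteMeasure μ] {γ : α → ι → ℝ} (hγ : ∀ i, Measurable fun x => γ x i) {C : ℝ}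
    (hC : ∀ x i, |γ x i| ≤ C) (M : Matrix ι ι ℝ) :
    Integrable (fun x => γ x ⬝ᵥ (M *ᵥ γ x)) μ := by
  simp only [dotProduct, Matrix.mulVec, Finset.mul_sum]
  refine integrable_finsetSum _ fun i _ => integrable_finsetSum _ fun j _ => ?_
  refine Integrable.of_bound (C := C * (|M i j| * C)) ?_ (.of_forall fun x => ?_)
  · exact ((hγ i).mul ((hγ j).const_mul _)).aestronglyMeasurable
  · rw [Real.norm_eq_abs, abs_mul, abs_mul]
    have h0 : 0 ≤ C := (abs_nonneg _).trans (hC x i)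
    gcongr
    · exact hC x i
    · exact hC x j

lemma measurable_crossCov {Q : Type*} {z : Q → Input p} (hF : ∀ z, Measurable (S.corrF z))
    (hD : ∀ z, Measurable (S.corrD z)) (i : Fin nf ⊕ Q) :
    Measurable fun x => S.crossCov z x i := by
  rcases i with i | i
  · simp only [crossCov, Pi.add_apply, Pi.smul_apply, Sum.elim_inl, smul_eq_mul, mul_zero, add_zero]
    exact (hF _).const_mul _
  · simp only [crossCov, Pi.add_apply, Pi.smul_apply, Sum.elim_inr, smul_eq_mul]
    exact ((hF _).const_mul _).add ((hD _).const_mul _)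

lemma abs_crossCov_le {Q : Type*} {z : Q → Input p} (hF : IsCorrelation S.corrF)
    (hD : IsCorrelation S.corrD) (x : Input p) (i : Fin nf ⊕ Q) :
    |S.crossCov z x i| ≤ S.varF + S.varD := by
  have h1 (x y : Input p) : |S.varF * S.corrF x y| ≤ S.varF := by
    rw [abs_mul, NNReal.abs_eq]
    exact mul_le_of_le_one_right S.varF.2 (IsCorrelation.abs_le_one hF x y)
  have h2 (x y : Input p) : |S.varD * S.corrD x y| ≤ S.varD := by
    rw [abs_mul, NNReal.abs_eq]
    exact mul_le_of_le_one_right S.varD.2 (IsCorrelation.abs_le_one hD x y)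
  rcases i with i | i
  · simp only [crossCov, Pi.add_apply, Pi.smul_apply, Sum.elim_inl, smul_eq_mul, mul_zero, add_zero]
    exact (h1 _ _).trans (le_add_of_nonneg_right S.varD.2)
  · simp only [crossCov, Pi.add_apply, Pi.smul_apply, Sum.elim_inr, smul_eq_mul]
    exact (abs_add_le _ _).trans (add_le_add (h1 _ _) (h2 _ _))

/-- By `predVar_eq` the integrand is a constant minus two quadratic forms in covariance vectors that
are bounded by `σ_f² + σ_δ²`. -/
lemma IsModel.integrable_explicitIntegrand (h : S.IsModel f δ ε P)
    (hF : ∀ z, Measurable (S.corrF z)) (hD : ∀ z, Measurable (S.corrD z))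
    (hΓ : IsUnit (S.gram (S.xPhys xnext)).det) :
    Integrable (S.explicitIntegrand f δ ε P xnext a) := by
  have e : S.explicitIntegrand f δ ε P xnext a = fun x => S.predVar f δ ε P xnext a x -
      S.crossCov (S.xPhys xnext) x ⬝ᵥ (((S.gram (S.xPhys xnext))⁻¹ *
        S.hMatrix f δ ε P xnext a * (S.gram (S.xPhys xnext))⁻¹) *ᵥ
          S.crossCov (S.xPhys xnext) x) := rfl
  rw [e]
  simp only [h.predVar_eq hΓ]
  exact ((integrable_const _).sub (integrable_dotProduct_mulVec (measurable_crossCov hF hD)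
    (abs_crossCov_le h.corrF h.corrD) _)).sub (integrable_dotProduct_mulVec
      (measurable_crossCov hF hD) (abs_crossCov_le h.corrF h.corrD) _)

end Integrability

end Experiment

end BiFidelity

theorem proposition3 {Ω : Type*} [MeasurableSpace Ω] (P : Measure Ω) [IsProbabilityMeasure P]
    {p nf no nc : ℕ} (S : BiFidelity.Experiment p nf no nc)
    (f δ : BiFidelity.Input p → Ω → ℝ) (ε : BiFidelity.Phys no nc → Ω → ℝ)
    (hmodel : S.IsModel f δ ε P)
    (hF : ∀ z, Measurable (S.corrF z)) (hD : ∀ z, Measurable (S.corrD z))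
    (xnext : BiFidelity.Input p) (hΓ : IsUnit (S.gram (S.xPhys xnext)).det) :
    -- the conditional laws given the exactly observed values exist and are unique
    (∀ x, ∃! κ, BiFidelity.IsContCondLaw
      (fun ω => (BiFidelity.Experiment.xi f δ x ω, S.latent f δ ε xnext ω))
      (S.exactData f δ ε xnext) P κ) ∧
    (∃! κ, BiFidelity.IsContCondLaw (S.latent f δ ε xnext) (S.exactData f δ ε xnext) P κ) ∧
    -- for all data values: the explicit form of the criterion and of the predictive variance
    ∀ a : BiFidelity.Data nf no,
      Integrable (S.cmse f δ ε P xnext a) ∧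
      Integrable (S.explicitIntegrand f δ ε P xnext a) ∧
      S.icmse f δ ε P xnext a = ∫ x, S.explicitIntegrand f δ ε P xnext a x ∧
      ∀ x, S.predVar f δ ε P xnext a x =
        (S.varF : ℝ) + (S.varD : ℝ) -
          S.crossCov S.xTrain x ⬝ᵥ
            (((S.gram S.xTrain)⁻¹ - (S.gram S.xTrain)⁻¹ *
              BiFidelity.Experiment.pad (S.censoredCov f δ ε P xnext a) *
              (S.gram S.xTrain)⁻¹) *ᵥ S.crossCov S.xTrain x) := by
  have := hmodel.isOpenPosMeasure_exactData hΓ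
  refine ⟨fun x => ?_, ?_, fun a => ?_⟩
  · obtain ⟨κ, hκ, -⟩ := hmodel.exists_isContCondLaw_xi_latent (x := x)
      -- Any decomposition with a residual orthogonal to the exact data would serve; the regression
      -- on all runs is one.
      (R := fun ω => BiFidelity.Experiment.xi f δ x ω - ∑ i, ((S.gram (S.xPhys xnext))⁻¹ *ᵥ
        S.crossCov (S.xPhys xnext) x) i * S.runs f δ ε xnext i ω) hΓ
      (Submodule.sub_mem _ (BiFidelity.Experiment.xi_mem_span x)
        (BiFidelity.Experiment.fun_sum_mem_span _ fun _ =>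
          BiFidelity.Experiment.runs_mem_span x _))
      (fun j => BiFidelity.covariance_sub_sum_inv_mulVec (hmodel.memLp_runs xnext)
        (hmodel.memLp_xi x) (hmodel.cov_runs_runs xnext) (hmodel.cov_runs_xi xnext x) hΓ _)
      (fun ω => (sub_add_cancel _ _).symm)
    exact hκ.existsUnique
  · obtain ⟨κ, hκ, -⟩ := hmodel.exists_isContCondLaw_latent hΓ
    exact hκ.existsUnique
  · have hcmse : S.cmse f δ ε P xnext a = S.explicitIntegrand f δ ε P xnext a :=
      funext fun x => hmodel.cmse_eq hΓ x
    have hint := hmodel.integrable_explicitIntegrand (a := a) hF hD hΓ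
    exact ⟨hcmse ▸ hint, hint, by rw [BiFidelity.Experiment.icmse, hcmse],
      fun x => hmodel.predVar_eq hΓ x⟩
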